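/- Let $\{g_0,g_1\}$ be a hyperbolic iterated function system (IFS) on $[0,1]$: two $C^1$ maps $g_i:[0,1]\to[0,1]$ with $0<\inf|g_i'|\le\sup|g_i'|<1$ and $0=g_0(0)<g_0(1)<g_1(0)<g_1(1)=1$. For a finite word $w=w_1\cdots w_n\in\{0,1\}^n$ put $|w|=n$ and $G_w=g_{w_1}\circ\cdots\circ g_{w_n}$, and let $y_w$ be the fixed point of $G_w$. The system satisfies the Livsic condition with parameter $\lambda$ if $G_w'(y_w)=\lambda^{|w|}$ for every non-empty finite word $w$. A self-conformal IFS $\{f_0,f_1\}$ (non-singular strict contractions of $[0,1]$ of class at least $C^1$) with attractor $X$, the unique non-empty compact set with $X=f_0(X)\cup f_1(X)$, is called pseudo-affine of slope $\lambda$ if $f_0'=f_1'=\lambda$ on $X$. Two systems $\{g_0,g_1\}$, $\{f_0,f_1\}$ are $C^s$-conjugate if $\{f_0,f_1\}=\{h\circ g_0\circ h^{-1},h\circ g_1\circ h^{-1}\}$ for some $C^s$-diffeomorphism $h$ of $[0,1]$. Here $C^s$ stands for $C^{r,\alpha}$ ($r$ times continuously differentiable with $\alpha$-Hölder $r$-th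 derivative; $r\ge1$ an integer, $0<\alpha\le1$), where $s=r+\alpha$; for $C^r$, $r\geq 1$ an integer, where $s=r$; or for $C^\infty$, where $s=\infty$. (1) There are $0<\lambda<1/2$ and a hyperbolic IFS $\{g_0,g_1\}$ of class $C^1$ satisfying the Livsic condition with parameter $\lambda$ that is not $C^1$-conjugate to any pseudo-affine IFS of class $C^1$ (of any slope). (2) Let $s>1$. If $\{g_0,g_1\}$ is a hyperbolic IFS of class $C^s$ that satisfies the Livsic condition with parameter $\lambda$ for some $0<\lambda<1$, then $\lambda<1/2$ and $\{g_0,g_1\}$ is $C^s$-conjugate to a hyperbolic pseudo-affine IFS of class $C^s$ and slope $\lambda$. -/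

import Mathlib

open Set

namespace TwoMapIFS

/-- The unit interval `[0,1]`. Every map below is a total function `ℝ → ℝ`, but only its values on
`[0,1]` matter; derivatives are taken within `[0,1]` (one-sided at the end points). -/
abbrev I : Set ℝ := Icc (0 : ℝ) 1

/-- Indices of regularity: `C^r`, `C^{r,α}` and `C^∞`. -/
inductive Regularity where
  | cont (r : ℕ) : Regularity
  | holder (r : ℕ) (α : ℝ) : Regularity
  | smooth : Regularity

/-- The indices in use: `C^r` with `r ≥ 1`, `C^{r,α}` with `r ≥ 1` and `0 < α ≤ 1`, and `C^∞`. -/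
def Regularity.Admissible : Regularity → Prop
  | .cont r => 1 ≤ r
  | .holder r α => 1 ≤ r ∧ 0 < α ∧ α ≤ 1
  | .smooth => True

/-- The numerical value of the regularity: `r`, `r + α` and `∞`, respectively. -/
noncomputable def Regularity.value : Regularity → EReal
  | .cont r => ((r : ℝ) : EReal)
  | .holder r α => (((r : ℝ) + α : ℝ) : EReal)
  | .smooth => ⊤

/-- `f` is of the given class on `[0,1]`. -/
def IsOfClass : Regularity → (ℝ → ℝ) → Prop
  | .cont r, f => ContDiffOn ℝ (r : WithTop ℕ∞) f I
  | .holder r α, f => ContDiffOn ℝ (r : WithTop ℕ∞) f I ∧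
      ∃ A : ℝ, ∀ u ∈ I, ∀ t ∈ I,
        |iteratedDerivWithin r f I u - iteratedDerivWithin r f I t| ≤ A * |u - t| ^ α
  | .smooth, f => ContDiffOn ℝ ((⊤ : ℕ∞) : WithTop ℕ∞) f I

/-- A self-conformal IFS on `[0,1]` with two generators: non-singular strict contractions of
`[0,1]` of class `C^s`. -/
structure IsSelfConformal (s : Regularity) (f : Fin 2 → ℝ → ℝ) : Prop where
  mapsTo : ∀ i, MapsTo (f i) I I
  isOfClass : ∀ i, IsOfClass s (f i)
  nonsingular : ∀ i, ∀ t ∈ I, derivWithin (f i) I t ≠ 0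
  contracting : ∃ c : ℝ, c < 1 ∧ ∀ i, ∀ x ∈ I, ∀ y ∈ I, |f i x - f i y| ≤ c * |x - y|

/-- A hyperbolic IFS of class `C^s`. -/
structure IsHyperbolic (s : Regularity) (f : Fin 2 → ℝ → ℝ) : Prop where
  isSelfConformal : IsSelfConformal s f
  deriv_bounds : ∃ m M : ℝ, 0 < m ∧ M < 1 ∧
    ∀ i, ∀ t ∈ I, m ≤ |derivWithin (f i) I t| ∧ |derivWithin (f i) I t| ≤ M
  zero_fixed : f 0 0 = 0
  lt_left : f 0 0 < f 0 1
  lt_gap : f 0 1 < f 1 0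
  lt_right : f 1 0 < f 1 1
  one_fixed : f 1 1 = 1

/-- `X` is the attractor of the IFS: a non-empty compact subset of `[0,1]` with
`X = f₀(X) ∪ f₁(X)`. -/
structure IsAttractor (f : Fin 2 → ℝ → ℝ) (X : Set ℝ) : Prop where
  subset : X ⊆ I
  nonempty : X.Nonempty
  isCompact : IsCompact X
  eq_iUnion : X = ⋃ i, f i '' X

/-- The derivatives of both maps equal `lam` on the attractor. -/
def IsPseudoAffine (f : Fin 2 → ℝ → ℝ) (lam : ℝ) : Prop :=
  ∃ X, IsAttractor f X ∧ ∀ i, ∀ x ∈ X, derivWithin (f i) I x = lam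

/-- `h` is a diffeomorphism of `[0,1]` of class `C^s`, with inverse `k`. -/
structure IsDiffeo (s : Regularity) (h k : ℝ → ℝ) : Prop where
  mapsTo : MapsTo h I I
  mapsTo_inv : MapsTo k I I
  left_inv : ∀ x ∈ I, k (h x) = x
  right_inv : ∀ x ∈ I, h (k x) = x
  isOfClass : IsOfClass s h
  isOfClass_inv : IsOfClass s k

/-- `C^s`-conjugacy of IFSs: `{f₀, f₁} = {h ∘ g₀ ∘ h⁻¹, h ∘ g₁ ∘ h⁻¹}` on `[0,1]` for some
`C^s`-diffeomorphism `h` of `[0,1]`. -/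
def IsConjugate (s : Regularity) (g f : Fin 2 → ℝ → ℝ) : Prop :=
  ∃ h k : ℝ → ℝ, IsDiffeo s h k ∧ ∃ σ : Equiv.Perm (Fin 2), ∀ i, ∀ x ∈ I,
    f (σ i) x = h (g i (k x))

/-- The cylinder map `G_w = g_{w₁} ∘ ⋯ ∘ g_{wₙ}`. -/
def wordMap (g : Fin 2 → ℝ → ℝ) : List (Fin 2) → ℝ → ℝ
  | [] => id
  | i :: w => g i ∘ wordMap g w

/-- The Livsic condition `G_w'(y_w) = lam ^ |w|`, where `y_w = G_w(y_w)`. For the empty word it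
reads `1 = 1` at every point of `[0,1]`. -/
def LivsicCondition (g : Fin 2 → ℝ → ℝ) (lam : ℝ) : Prop :=
  ∀ w : List (Fin 2), ∀ y ∈ I, wordMap g w y = y →
    derivWithin (wordMap g w) I y = lam ^ w.length

end TwoMapIFS

/-! Positive statement. Conjugating by the primitive of a positive density `ρ` turns the slope of `g
i` at `x` into `ρ (g i x) * g i' x / ρ x`, so a density is wanted for which this quotient is `lam`
on the attractor. For `i = 0` alone it is found by summing `log (g 0' / lam)` along `g 0`-orbits.
The series converges because these orbits tend to `0` geometrically, the derivative is Hölder, and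
the Livsic condition gives `g 0' 0 = lam`. For an arbitrary word `w`, the Livsic condition is
applied to `0 ⋯ 0 w`: the leading zeros cancel by the choice of `ρ`, and the fixed points tend to
`0` (`density_wordMap_zero`). Comparing `i :: w` with `w` gives the relation for both maps on the
orbit of `0`, hence on its closure, which is an attractor.

Off the attractor the slopes given by `ρ` need not be below `1`. The transfer operator repairs this.
On the attractor its `j`-th iterate multiplies `ρ` by `(2 * lam) ^ j`, and by bounded distortion
this controls the growth on all of `[0,1]`. If `lam ≥ 1/2`, each generation of gaps would have
`ρ`-mass bounded below, which is impossible; so `lam < 1/2` (`slope_lt_half`). Then, for `2 * lam <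
θ < 1`, a finite sum of iterates with weights `θ⁻¹ ^ j` is a density whose slopes are at most `θ`
everywhere and still `lam` on the attractor (`exists_adapted_density`). Regularity follows from
differentiating the cohomological equation, which becomes contracting (`cls_coboundary`).

Counterexample. Start from the affine maps `x/4` and `(x+3)/4`, and conjugate by a homeomorphism
with formal density `exp (∑ j, weight j * fold^[j] x)`. The weights tend to `0` with divergent sum
but summable differences. The exponent may therefore be infinite, yet its change along each branch
is a continuous function, so the conjugate maps are `C^1`. Around a periodic orbit the changes
cancel, which is the Livsic condition with `lam = 1/4`. Along `1 ⋯ 1` they add up to an unbounded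
sum, whereas a `C^1` conjugacy to a pseudo-affine system would bound `4 ^ |w| * G_w' 0`
(`not_conjugate_of_unbounded`). The homeomorphism exists because the approximating densities are
bounded in `L²` (`integral_exp_birkhoff_le`). -/

namespace TwoMapIFS

open Filter Topology

/-! ### Regularity classes on the unit interval -/

/-- Continuity on `[0,1]` (for `none`) or `α`-Hölder continuity on `[0,1]` (for `some α`). -/
def Base : Option ℝ → (ℝ → ℝ) → Prop
  | none, f => ContinuousOn f I
  | some α, f => ∃ A : ℝ, ∀ u ∈ I, ∀ t ∈ I, |f u - f t| ≤ A * |u - t| ^ α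

/-- The Hölder exponents in use lie in `(0,1]`. -/
def ValidExp : Option ℝ → Prop
  | none => True
  | some α => 0 < α ∧ α ≤ 1

/-- `m` times differentiable on `[0,1]`, the last derivative satisfying `Base β`. -/
def Cls (β : Option ℝ) : ℕ → (ℝ → ℝ) → Prop
  | 0, f => Base β f
  | m + 1, f => ∃ f' : ℝ → ℝ, (∀ x ∈ I, HasDerivWithinAt f (f' x) I x) ∧ Cls β m f'

theorem abs_sub_le_one {x y : ℝ} (hx : x ∈ I) (hy : y ∈ I) : |x - y| ≤ 1 := by
  rw [abs_le]; constructor <;> linarith [hx.1, hx.2, hy.1, hy.2]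

theorem abs_le_rpow {t α : ℝ} (ht : |t| ≤ 1) (h0 : 0 < α) (h1 : α ≤ 1) : |t| ≤ |t| ^ α := by
  rcases (abs_nonneg t).eq_or_lt with h | h
  · rw [← h, Real.zero_rpow h0.ne']
  · simpa using Real.rpow_le_rpow_of_exponent_ge h ht h1

theorem hasDerivWithinAt_unique {f : ℝ → ℝ} {a b x : ℝ} (hx : x ∈ I)
    (ha : HasDerivWithinAt f a I x) (hb : HasDerivWithinAt f b I x) : a = b := by
  have hu : UniqueDiffWithinAt ℝ I x := uniqueDiffOn_Icc zero_lt_one x hx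
  rw [← ha.derivWithin hu, ← hb.derivWithin hu]

theorem HasDerivWithinAt.derivWithin_I {f : ℝ → ℝ} {a x : ℝ} (hx : x ∈ I)
    (ha : HasDerivWithinAt f a I x) : derivWithin f I x = a :=
  ha.derivWithin (uniqueDiffOn_Icc zero_lt_one x hx)

theorem lipschitz_of_deriv_le {f f' : ℝ → ℝ} {C : ℝ}
    (hf : ∀ x ∈ I, HasDerivWithinAt f (f' x) I x) (hC : ∀ x ∈ I, |f' x| ≤ C) :
    ∀ x ∈ I, ∀ y ∈ I, |f x - f y| ≤ C * |x - y| := by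
  intro x hx y hy
  have := Convex.norm_image_sub_le_of_norm_hasDerivWithin_le hf hC (convex_Icc 0 1) hy hx
  simpa [Real.norm_eq_abs] using this

theorem eq_of_deriv_eq {f g f' : ℝ → ℝ}
    (hf : ∀ x ∈ I, HasDerivWithinAt f (f' x) I x) (hg : ∀ x ∈ I, HasDerivWithinAt g (f' x) I x)
    (h0 : f 0 = g 0) : ∀ x ∈ I, f x = g x := by
  intro x hx
  have := lipschitz_of_deriv_le (f := fun x => f x - g x) (f' := fun x => f' x - f' x) (C := 0)
    (fun x hx => (hf x hx).sub (hg x hx)) (by simp) x hx 0 (by simp)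
  simp only [h0, sub_self, sub_zero, zero_mul] at this
  linarith [abs_nonpos_iff.1 this]

theorem exists_abs_bound {f : ℝ → ℝ} (hf : ContinuousOn f I) :
    ∃ C, 0 ≤ C ∧ ∀ x ∈ I, |f x| ≤ C := by
  obtain ⟨C, hC⟩ := isCompact_Icc.exists_bound_of_continuousOn hf
  exact ⟨C, (abs_nonneg (f 0)).trans (hC 0 (by simp)), hC⟩

theorem exists_pos_lower_bound {f : ℝ → ℝ} (hf : ContinuousOn f I) (hpos : ∀ x ∈ I, 0 < f x) :
    ∃ c, 0 < c ∧ ∀ x ∈ I, c ≤ f x := by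
  obtain ⟨x, hx, hmin⟩ := isCompact_Icc.exists_isMinOn (s := I) ⟨0, by simp⟩ hf
  exact ⟨f x, hpos x hx, fun y hy => hmin hy⟩

theorem exists_primitive {v : ℝ → ℝ} (hv : ContinuousOn v I) (c : ℝ) :
    ∃ V : ℝ → ℝ, V 0 = c ∧ ∀ x ∈ I, HasDerivWithinAt V (v x) I x := by
  have hc : Continuous (IccExtend zero_le_one (I.domRestrict v) : ℝ → ℝ) :=
    (continuousOn_iff_continuous_domRestrict.1 hv).Icc_extend'
  refine ⟨fun x => c + ∫ t in (0 : ℝ)..x, IccExtend zero_le_one (I.domRestrict v) t, by simp, ?_⟩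
  intro x hx
  have := (hc.integral_hasStrictDerivAt 0 x).hasDerivAt.const_add c
  rw [IccExtend_of_mem _ _ hx] at this
  exact this.hasDerivWithinAt

/-! ### Closure properties of continuous and Hölder functions -/

section Base

variable {β : Option ℝ}

theorem base_of_lipschitz (hβ : ValidExp β) {f : ℝ → ℝ} {L : ℝ}
    (h : ∀ x ∈ I, ∀ y ∈ I, |f x - f y| ≤ L * |x - y|) : Base β f := by
  have h' : ∀ x ∈ I, ∀ y ∈ I, |f x - f y| ≤ |L| * |x - y| := fun x hx y hy =>
    (h x hx y hy).trans (by gcongr; exact le_abs_self L)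
  cases β with
  | none =>
    refine LipschitzOnWith.continuousOn (K := ⟨|L|, abs_nonneg _⟩) (LipschitzOnWith.of_dist_le_mul ?_)
    intro x hx y hy
    exact h' x hx y hy
  | some α =>
    refine ⟨|L|, fun x hx y hy => (h' x hx y hy).trans ?_⟩
    gcongr
    exact abs_le_rpow (abs_sub_le_one hx hy) hβ.1 hβ.2

theorem continuousOn_of_lipschitz {f : ℝ → ℝ} {L : ℝ}
    (h : ∀ x ∈ I, ∀ y ∈ I, |f x - f y| ≤ L * |x - y|) : ContinuousOn f I :=
  base_of_lipschitz (β := none) trivial h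

theorem Base.holder_nonneg {α : ℝ} {f : ℝ → ℝ} (h : Base (some α) f) :
    ∃ A : ℝ, 0 ≤ A ∧ ∀ u ∈ I, ∀ t ∈ I, |f u - f t| ≤ A * |u - t| ^ α := by
  obtain ⟨A, hA⟩ := h
  refine ⟨|A|, abs_nonneg _, fun u hu t ht => (hA u hu t ht).trans ?_⟩
  gcongr
  exact le_abs_self A

theorem Base.continuousOn (hβ : ValidExp β) {f : ℝ → ℝ} (h : Base β f) : ContinuousOn f I := by
  cases β with
  | none => exact h
  | some α =>
    obtain ⟨A, hA0, hA⟩ := h.holder_nonneg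
    intro x hx
    have ht : Tendsto (fun y => A * |y - x| ^ α) (𝓝[I] x) (𝓝 0) := by
      have : Continuous fun y : ℝ => A * |y - x| ^ α :=
        continuous_const.mul
          ((continuous_abs.comp (continuous_id.sub continuous_const)).rpow_const
            fun _ => Or.inr hβ.1.le)
      have h2 := (this.tendsto x).mono_left (nhdsWithin_le_nhds (s := I))
      simpa [Real.zero_rpow hβ.1.ne'] using h2
    refine tendsto_iff_dist_tendsto_zero.2 (squeeze_zero' (Eventually.of_forall fun _ => dist_nonneg)
      ?_ ht)
    filter_upwards [self_mem_nhdsWithin] with y hy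
    exact hA y hy x hx

/-- Closure of `Base` under operations that are jointly Lipschitz along the given functions. -/
theorem base_of_le (hβ : ValidExp β) {f g F : ℝ → ℝ} (hf : Base β f) (hg : Base β g) {L K : ℝ}
    (hF : ContinuousOn f I → ContinuousOn g I → ContinuousOn F I) (hL : 0 ≤ L) (hK : 0 ≤ K)
    (h : ∀ x ∈ I, ∀ y ∈ I, |F x - F y| ≤ L * |f x - f y| + K * |g x - g y|) : Base β F := by
  cases β with
  | none => exact hF hf hg
  | some α =>
    obtain ⟨A, hA0, hA⟩ := hf.holder_nonneg
    obtain ⟨B, hB0, hB⟩ := hg.holder_nonneg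
    refine ⟨L * A + K * B, fun x hx y hy => (h x hx y hy).trans ?_⟩
    calc L * |f x - f y| + K * |g x - g y|
        ≤ L * (A * |x - y| ^ α) + K * (B * |x - y| ^ α) := by
          gcongr
          · exact hA x hx y hy
          · exact hB x hx y hy
      _ = (L * A + K * B) * |x - y| ^ α := by ring

theorem Base.congr {f g : ℝ → ℝ} (hf : Base β f) (h : ∀ x ∈ I, g x = f x) : Base β g := by
  cases β with
  | none => exact ContinuousOn.congr hf h
  | some α =>
    obtain ⟨A, hA⟩ := hf
    exact ⟨A, fun x hx y hy => by rw [h x hx, h y hy]; exact hA x hx y hy⟩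

theorem Base.add (hβ : ValidExp β) {f g : ℝ → ℝ} (hf : Base β f) (hg : Base β g) :
    Base β fun x => f x + g x := by
  refine base_of_le hβ hf hg (L := 1) (K := 1) (fun h1 h2 => h1.add h2) zero_le_one zero_le_one ?_
  intro x _ y _
  rw [one_mul, one_mul, show f x + g x - (f y + g y) = (f x - f y) + (g x - g y) by ring]
  exact abs_add_le _ _

theorem Base.mul (hβ : ValidExp β) {f g : ℝ → ℝ} (hf : Base β f) (hg : Base β g) :
    Base β fun x => f x * g x := by
  obtain ⟨C, hC0, hC⟩ := exists_abs_bound (hf.continuousOn hβ)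
  obtain ⟨D, hD0, hD⟩ := exists_abs_bound (hg.continuousOn hβ)
  refine base_of_le hβ hf hg (L := D) (K := C) (fun h1 h2 => h1.mul h2) hD0 hC0 ?_
  intro x hx y hy
  rw [show f x * g x - f y * g y = g x * (f x - f y) + f y * (g x - g y) by ring]
  refine (abs_add_le _ _).trans ?_
  rw [abs_mul, abs_mul]
  gcongr
  · exact hD x hx
  · exact hC y hy

theorem Base.comp {f g : ℝ → ℝ} (hf : Base β f) {L : ℝ} (hm : MapsTo g I I)
    (hβ : ValidExp β) (hg : ∀ x ∈ I, ∀ y ∈ I, |g x - g y| ≤ L * |x - y|) :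
    Base β fun x => f (g x) := by
  cases β with
  | none => exact ContinuousOn.comp hf (continuousOn_of_lipschitz hg) hm
  | some α =>
    obtain ⟨A, hA0, hA⟩ := hf.holder_nonneg
    refine ⟨A * |L| ^ α, fun x hx y hy => (hA _ (hm hx) _ (hm hy)).trans ?_⟩
    rw [mul_assoc, ← Real.mul_rpow (abs_nonneg _) (abs_nonneg _)]
    have : |g x - g y| ≤ |L| * |x - y| := (hg x hx y hy).trans (by gcongr; exact le_abs_self L)
    exact mul_le_mul_of_nonneg_left (Real.rpow_le_rpow (abs_nonneg _) this hβ.1.le) hA0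

theorem Base.exp (hβ : ValidExp β) {f : ℝ → ℝ} (hf : Base β f) : Base β fun x => Real.exp (f x) := by
  obtain ⟨C, hC0, hC⟩ := exists_abs_bound (hf.continuousOn hβ)
  refine base_of_le hβ hf hf (L := Real.exp C) (K := 0) (fun h1 _ => h1.rexp) (Real.exp_nonneg _)
    le_rfl ?_
  have key : ∀ a b : ℝ, |a| ≤ C → Real.exp a - Real.exp b ≤ Real.exp C * |a - b| := by
    intro a b ha
    have h1 : Real.exp b = Real.exp a * Real.exp (b - a) := by rw [← Real.exp_add]; ring_nf
    have h2 := Real.add_one_le_exp (b - a)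
    have h3 : Real.exp a ≤ Real.exp C := Real.exp_le_exp.2 ((le_abs_self a).trans ha)
    calc Real.exp a - Real.exp b ≤ Real.exp a * (a - b) := by
          rw [h1]; nlinarith [Real.exp_pos a]
      _ ≤ Real.exp a * |a - b| := by gcongr; exact le_abs_self _
      _ ≤ _ := by gcongr
  intro x hx y hy
  rw [zero_mul, add_zero, abs_le]
  have h1 := key _ (f y) (hC x hx)
  have h2 := key _ (f x) (hC y hy)
  rw [abs_sub_comm] at h2
  constructor <;> linarith

theorem Base.inv (hβ : ValidExp β) {f : ℝ → ℝ} (hf : Base β f) (hpos : ∀ x ∈ I, 0 < f x) :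
    Base β fun x => (f x)⁻¹ := by
  obtain ⟨c, hc0, hc⟩ := exists_pos_lower_bound (hf.continuousOn hβ) hpos
  refine base_of_le hβ hf hf (L := (c * c)⁻¹) (K := 0)
    (fun h1 _ => h1.inv₀ fun x hx => (hpos x hx).ne') (by positivity) le_rfl ?_
  intro x hx y hy
  have hx0 := hpos x hx
  have hy0 := hpos y hy
  rw [zero_mul, add_zero, show (f x)⁻¹ - (f y)⁻¹ = (f x * f y)⁻¹ * (f y - f x) by field_simp,
    abs_mul, abs_sub_comm (f y), abs_of_pos (by positivity : 0 < (f x * f y)⁻¹)]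
  gcongr
  · exact hc x hx
  · exact hc y hy

theorem Base.log (hβ : ValidExp β) {f : ℝ → ℝ} (hf : Base β f) (hpos : ∀ x ∈ I, 0 < f x) :
    Base β fun x => Real.log (f x) := by
  obtain ⟨c, hc0, hc⟩ := exists_pos_lower_bound (hf.continuousOn hβ) hpos
  refine base_of_le hβ hf hf (L := c⁻¹) (K := 0)
    (fun h1 _ => h1.log fun x hx => (hpos x hx).ne') (by positivity) le_rfl ?_
  have key : ∀ a b : ℝ, c ≤ a → c ≤ b → Real.log a - Real.log b ≤ c⁻¹ * |a - b| := by
    intro a b ha hb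
    have ha0 := hc0.trans_le ha
    have hb0 := hc0.trans_le hb
    rw [← Real.log_div ha0.ne' hb0.ne']
    calc Real.log (a / b) ≤ a / b - 1 := Real.log_le_sub_one_of_pos (by positivity)
      _ = b⁻¹ * (a - b) := by field_simp
      _ ≤ b⁻¹ * |a - b| := by gcongr; exact le_abs_self _
      _ ≤ c⁻¹ * |a - b| := by gcongr
  intro x hx y hy
  rw [zero_mul, add_zero, abs_le]
  have h1 := key _ _ (hc x hx) (hc y hy)
  have h2 := key _ _ (hc y hy) (hc x hx)
  rw [abs_sub_comm] at h2
  constructor <;> linarith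

end Base

/-! ### Closure properties of the differentiable classes -/

section Cls

variable {β : Option ℝ}

theorem Cls.congr {m : ℕ} {f g : ℝ → ℝ} (hf : Cls β m f) (h : ∀ x ∈ I, g x = f x) : Cls β m g := by
  cases m with
  | zero => exact Base.congr hf h
  | succ m =>
    obtain ⟨f', hf', hm⟩ := hf
    exact ⟨f', fun x hx => (hf' x hx).congr h (h x hx), hm⟩

theorem Cls.continuousOn (hβ : ValidExp β) {m : ℕ} {f : ℝ → ℝ} (hf : Cls β m f) :
    ContinuousOn f I := by
  cases m with
  | zero => exact Base.continuousOn hβ hf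
  | succ m => exact fun x hx => (hf.choose_spec.1 x hx).continuousWithinAt

theorem Cls.lipschitz (hβ : ValidExp β) {m : ℕ} {f : ℝ → ℝ} (hf : Cls β (m + 1) f) :
    ∃ L : ℝ, ∀ x ∈ I, ∀ y ∈ I, |f x - f y| ≤ L * |x - y| := by
  obtain ⟨f', hf', hm⟩ := hf
  obtain ⟨C, -, hC⟩ := exists_abs_bound (hm.continuousOn hβ)
  exact ⟨C, lipschitz_of_deriv_le hf' hC⟩

theorem Cls.of_succ (hβ : ValidExp β) {m : ℕ} {f : ℝ → ℝ} (hf : Cls β (m + 1) f) :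
    Cls β m f := by
  induction m generalizing f with
  | zero => exact base_of_lipschitz hβ (hf.lipschitz hβ).choose_spec
  | succ m ih =>
    obtain ⟨f', hf', hm⟩ := hf
    exact ⟨f', hf', ih hm⟩

theorem Cls.of_deriv {m : ℕ} {f f' : ℝ → ℝ} (hf : Cls β (m + 1) f)
    (h : ∀ x ∈ I, HasDerivWithinAt f (f' x) I x) : Cls β m f' := by
  obtain ⟨d, hd, hm⟩ := hf
  exact hm.congr fun x hx => hasDerivWithinAt_unique hx (h x hx) (hd x hx)

theorem Cls.const (hβ : ValidExp β) (c : ℝ) (m : ℕ) : Cls β m fun _ => c := by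
  induction m generalizing c with
  | zero => exact base_of_lipschitz hβ (L := 0) (by simp)
  | succ m ih => exact ⟨fun _ => 0, fun x _ => hasDerivWithinAt_const x I c, ih 0⟩

theorem Cls.add (hβ : ValidExp β) {m : ℕ} {f g : ℝ → ℝ} (hf : Cls β m f) (hg : Cls β m g) :
    Cls β m fun x => f x + g x := by
  induction m generalizing f g with
  | zero => exact Base.add hβ hf hg
  | succ m ih =>
    obtain ⟨f', hf', hfm⟩ := hf
    obtain ⟨g', hg', hgm⟩ := hg
    exact ⟨_, fun x hx => (hf' x hx).add (hg' x hx), ih hfm hgm⟩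

theorem Cls.mul (hβ : ValidExp β) {m : ℕ} {f g : ℝ → ℝ} (hf : Cls β m f) (hg : Cls β m g) :
    Cls β m fun x => f x * g x := by
  induction m generalizing f g with
  | zero => exact Base.mul hβ hf hg
  | succ m ih =>
    have hf0 := hf.of_succ hβ
    have hg0 := hg.of_succ hβ
    obtain ⟨f', hf', hfm⟩ := hf
    obtain ⟨g', hg', hgm⟩ := hg
    exact ⟨_, fun x hx => (hf' x hx).mul (hg' x hx), (ih hfm hg0).add hβ (ih hf0 hgm)⟩

/-- The Lipschitz bound is a separate hypothesis because at `m = 0` the class of `g` is only Hölder,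
and composing two Hölder functions lowers the exponent. -/
theorem Cls.comp (hβ : ValidExp β) {m : ℕ} {f g : ℝ → ℝ} (hf : Cls β m f) (hg : Cls β m g)
    (hm : MapsTo g I I) {L : ℝ} (hL : ∀ x ∈ I, ∀ y ∈ I, |g x - g y| ≤ L * |x - y|) :
    Cls β m fun x => f (g x) := by
  induction m generalizing f with
  | zero => exact Base.comp hf hm hβ hL
  | succ m ih =>
    have hg0 := hg.of_succ hβ
    obtain ⟨f', hf', hfm⟩ := hf
    obtain ⟨g', hg', hgm⟩ := hg
    exact ⟨_, fun x hx => (hf' (g x) (hm hx)).comp x (hg' x hx) hm, (ih hfm hg0).mul hβ hgm⟩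

theorem Cls.exp (hβ : ValidExp β) {m : ℕ} {f : ℝ → ℝ} (hf : Cls β m f) :
    Cls β m fun x => Real.exp (f x) := by
  induction m generalizing f with
  | zero => exact Base.exp hβ hf
  | succ m ih =>
    have hf0 := hf.of_succ hβ
    obtain ⟨f', hf', hfm⟩ := hf
    exact ⟨_, fun x hx => (hf' x hx).exp, (ih hf0).mul hβ hfm⟩

theorem Cls.inv (hβ : ValidExp β) {m : ℕ} {f : ℝ → ℝ} (hf : Cls β m f) (hpos : ∀ x ∈ I, 0 < f x) :
    Cls β m fun x => (f x)⁻¹ := by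
  induction m generalizing f with
  | zero => exact Base.inv hβ hf hpos
  | succ m ih =>
    have hi := ih (hf.of_succ hβ) hpos
    obtain ⟨f', hf', hfm⟩ := hf
    refine ⟨_, fun x hx => (hf' x hx).inv (hpos x hx).ne', ?_⟩
    refine (((Cls.const hβ (-1) m).mul hβ hfm).mul hβ (hi.mul hβ hi)).congr fun x hx => ?_
    have := (hpos x hx).ne'
    field_simp

theorem Cls.log (hβ : ValidExp β) {m : ℕ} {f : ℝ → ℝ} (hf : Cls β m f) (hpos : ∀ x ∈ I, 0 < f x) :
    Cls β m fun x => Real.log (f x) := by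
  cases m with
  | zero => exact Base.log hβ hf hpos
  | succ m =>
    have hi := (hf.of_succ hβ).inv hβ hpos
    obtain ⟨f', hf', hfm⟩ := hf
    refine ⟨_, fun x hx => (hf' x hx).log (hpos x hx).ne', ?_⟩
    exact (hfm.mul hβ hi).congr fun x _ => div_eq_mul_inv _ _

theorem cls_iff (hβ : ValidExp β) {m : ℕ} {f : ℝ → ℝ} :
    Cls β m f ↔
      ContDiffOn ℝ (m : WithTop ℕ∞) f I ∧ Base β (iteratedDerivWithin m f I) := by
  have hu : UniqueDiffOn ℝ I := uniqueDiffOn_Icc zero_lt_one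
  induction m generalizing f with
  | zero =>
    have e : ∀ x ∈ I, iteratedDerivWithin 0 f I x = f x := fun x _ => by simp
    rw [CharP.cast_eq_zero, contDiffOn_zero]
    exact ⟨fun h => ⟨Base.continuousOn hβ h, Base.congr h e⟩,
      fun h => Base.congr h.2 fun x hx => (e x hx).symm⟩
  | succ m ih =>
    rw [Nat.cast_add, Nat.cast_one, contDiffOn_succ_iff_derivWithin hu, iteratedDerivWithin_succ',
      and_assoc, and_assoc]
    constructor
    · rintro ⟨f', hf', hm⟩
      refine ⟨fun x hx => (hf' x hx).differentiableWithinAt, fun h => ?_, ih.1 ?_⟩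
      -- The analyticity clause of the `ContDiffOn` recursion is vacuous at finite order.
      · exact absurd h (by exact_mod_cast WithTop.coe_ne_top)
      · exact hm.congr fun x hx => (hf' x hx).derivWithin (hu x hx)
    · rintro ⟨hd, -, hm⟩
      exact ⟨_, fun x hx => (hd x hx).hasDerivWithinAt, ih.2 hm⟩

end Cls

/-! ### Regularity indices as families of differentiable classes -/

/-- The pairs `(β, m)` such that the given class is the intersection of the classes
`Cls β (m + 1)`. -/
def Regularity.indices : Regularity → Set (Option ℝ × ℕ)
  | .cont r => {(none, r - 1)}
  | .holder r α => {(some α, r - 1)}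
  | .smooth => {p | p.1 = none ∧ 1 ≤ p.2}

theorem Regularity.Admissible.validExp {s : Regularity} (hs : s.Admissible) :
    ∀ p ∈ s.indices, ValidExp p.1 := by
  rintro ⟨β, m⟩ hp
  cases s with
  | cont r => simp only [indices, mem_singleton_iff, Prod.mk.injEq] at hp; rw [hp.1]; trivial
  | holder r α =>
    simp only [indices, mem_singleton_iff, Prod.mk.injEq] at hp; rw [hp.1]; exact hs.2
  | smooth => simp only [indices, mem_ofPred_eq] at hp; rw [hp.1]; trivial

theorem Regularity.Admissible.isOfClass_iff {s : Regularity} (hs : s.Admissible) {f : ℝ → ℝ} :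
    IsOfClass s f ↔ ∀ p ∈ s.indices, Cls p.1 (p.2 + 1) f := by
  cases s with
  | cont r =>
    have hr : 1 ≤ r := hs
    simp only [indices, mem_singleton_iff, forall_eq, IsOfClass, Nat.sub_add_cancel hr]
    rw [cls_iff (by trivial)]
    exact ⟨fun h => ⟨h, h.continuousOn_iteratedDerivWithin le_rfl (uniqueDiffOn_Icc zero_lt_one)⟩,
      fun h => h.1⟩
  | holder r α =>
    simp only [indices, mem_singleton_iff, forall_eq, IsOfClass, Nat.sub_add_cancel hs.1]
    rw [cls_iff (β := some α) hs.2]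
    rfl
  | smooth =>
    simp only [indices, mem_ofPred_eq, IsOfClass]
    rw [contDiffOn_infty]
    constructor
    · rintro h ⟨β, m⟩ ⟨rfl, -⟩
      rw [cls_iff (by trivial)]
      exact ⟨h _, (h _).continuousOn_iteratedDerivWithin le_rfl (uniqueDiffOn_Icc zero_lt_one)⟩
    · intro h n
      have := h (none, n + 1) ⟨rfl, by simp⟩
      rw [cls_iff (by trivial)] at this
      exact this.1.of_le (by exact_mod_cast (by omega : n ≤ n + 1 + 1))

theorem Regularity.indices_nonempty (s : Regularity) : s.indices.Nonempty := by
  cases s with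
  | cont r => exact ⟨_, rfl⟩
  | holder r α => exact ⟨_, rfl⟩
  | smooth => exact ⟨(none, 1), rfl, le_rfl⟩

theorem Cls.of_le {β : Option ℝ} (hβ : ValidExp β) {m n : ℕ} {f : ℝ → ℝ} (h : m ≤ n)
    (hf : Cls β n f) : Cls β m f := by
  induction n, h using Nat.le_induction with
  | base => exact hf
  | succ n _ ih => exact ih (hf.of_succ hβ)

/-- A class above `C^1` is contained in some `C^{1,α}`. -/
theorem Regularity.Admissible.exists_holder {s : Regularity} (hs : s.Admissible)
    (h1 : 1 < s.value) : ∃ α : ℝ, 0 < α ∧ α ≤ 1 ∧ ∀ f, IsOfClass s f → Cls (some α) 1 f := by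
  have key : ∀ f, Cls none 2 f → Cls (some 1) 1 f := by
    rintro f ⟨f', hf', hm⟩
    exact ⟨f', hf', base_of_lipschitz (β := some 1) ⟨one_pos, le_rfl⟩
      (Cls.lipschitz (β := none) trivial hm).choose_spec⟩
  cases s with
  | cont r =>
    refine ⟨1, one_pos, le_rfl, fun f hf => key f ?_⟩
    have hr : 1 < r := by
      simp only [value] at h1
      exact_mod_cast h1
    rw [hs.isOfClass_iff] at hf
    exact Cls.of_le (β := none) trivial (by simp only; omega) (hf _ rfl)
  | holder r α =>
    refine ⟨α, hs.2.1, hs.2.2, fun f hf => ?_⟩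
    rw [hs.isOfClass_iff] at hf
    exact Cls.of_le (β := some α) hs.2 (by omega) (hf _ rfl)
  | smooth =>
    refine ⟨1, one_pos, le_rfl, fun f hf => key f ?_⟩
    rw [hs.isOfClass_iff] at hf
    exact hf (none, 1) ⟨rfl, le_rfl⟩

/-! ### Inverse functions on the unit interval -/

/-- A linear lower bound on increments gives injectivity and a `c⁻¹`-Lipschitz inverse, and the
intermediate value theorem gives surjectivity. No derivative of `h` is used, so this also serves the
homeomorphism of the counterexample. -/
theorem exists_inverse {h : ℝ → ℝ} (hc : ContinuousOn h I) (h0 : h 0 = 0) (h1 : h 1 = 1) {c : ℝ}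
    (hpos : 0 < c) (hh : ∀ x ∈ I, ∀ y ∈ I, x ≤ y → c * (y - x) ≤ h y - h x) :
    ∃ k : ℝ → ℝ, MapsTo h I I ∧ MapsTo k I I ∧ (∀ x ∈ I, k (h x) = x) ∧ (∀ x ∈ I, h (k x) = x) ∧
      (∀ x ∈ I, ∀ y ∈ I, |k x - k y| ≤ c⁻¹ * |x - y|) := by
  have hmono : ∀ x ∈ I, ∀ y ∈ I, x ≤ y → h x ≤ h y := fun x hx y hy hxy => by
    have := hh x hx y hy hxy
    nlinarith
  have hlow : ∀ x ∈ I, ∀ y ∈ I, c * |x - y| ≤ |h x - h y| := by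
    intro x hx y hy
    rcases le_total x y with hxy | hxy
    · rw [abs_sub_comm x, abs_sub_comm (h x), abs_of_nonneg (sub_nonneg.2 hxy)]
      exact (hh x hx y hy hxy).trans (le_abs_self _)
    · rw [abs_of_nonneg (sub_nonneg.2 hxy)]
      exact (hh y hy x hx hxy).trans (le_abs_self _)
  have hinj : ∀ x ∈ I, ∀ y ∈ I, h x = h y → x = y := by
    intro x hx y hy hxy
    have := hlow x hx y hy
    rw [hxy, sub_self, abs_zero] at this
    have h3 : |x - y| ≤ 0 := by
      by_contra hcon
      push Not at hcon
      nlinarith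
    linarith [abs_nonpos_iff.1 h3]
  have hmaps : MapsTo h I I := fun x hx =>
    ⟨by rw [← h0]; exact hmono 0 (by simp) x hx hx.1, by rw [← h1]; exact hmono x hx 1 (by simp) hx.2⟩
  have hsurj : SurjOn h I I := by
    have := intermediate_value_Icc (zero_le_one (α := ℝ)) hc
    rw [h0, h1] at this
    exact this
  refine ⟨Function.invFunOn h I, hmaps, hsurj.mapsTo_invFunOn, ?_, ?_, ?_⟩
  · intro x hx
    exact hinj _ (hsurj.mapsTo_invFunOn (hmaps hx)) _ hx (hsurj.rightInvOn_invFunOn (hmaps hx))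
  · exact fun x hx => hsurj.rightInvOn_invFunOn hx
  · intro x hx y hy
    have := hlow _ (hsurj.mapsTo_invFunOn hx) _ (hsurj.mapsTo_invFunOn hy)
    rw [hsurj.rightInvOn_invFunOn hx, hsurj.rightInvOn_invFunOn hy] at this
    rwa [inv_mul_eq_div, le_div_iff₀ hpos, mul_comm]

theorem hasDerivWithinAt_inverse {h k : ℝ → ℝ} {d x : ℝ} (hx : x ∈ I) (hk : MapsTo k I I)
    (hr : ∀ x ∈ I, h (k x) = x) (hkc : ContinuousOn k I) (hd : HasDerivWithinAt h d I (k x))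
    (hd0 : d ≠ 0) : HasDerivWithinAt k d⁻¹ I x := by
  have e : HasFDerivWithinAt h
      ((ContinuousLinearEquiv.unitsEquivAut ℝ (Units.mk0 d hd0) : ℝ ≃L[ℝ] ℝ) : ℝ →L[ℝ] ℝ) I (k x) :=
    hd.hasFDerivWithinAt.congr_fderiv (by ext; simp)
  have := HasFDerivWithinAt.of_local_left_inverse (g := k) (f := h) (s := I) (t := I) (a := x)
    (tendsto_nhdsWithin_iff.2 ⟨hkc x hx, by
      filter_upwards [self_mem_nhdsWithin] with y hy using hk hy⟩) e hx
    (by filter_upwards [self_mem_nhdsWithin] with y hy using hr y hy)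
  exact this.hasDerivWithinAt.congr_deriv (by simp)

/-- Bootstrapping: since `k' = 1 / (ρ ∘ k)`, each degree of regularity of `k` yields the next one,
starting from the Lipschitz bound. -/
theorem cls_inverse {β : Option ℝ} (hβ : ValidExp β) {h k ρ : ℝ → ℝ} (hk : MapsTo k I I)
    (hr : ∀ x ∈ I, h (k x) = x) {L : ℝ} (hL : ∀ x ∈ I, ∀ y ∈ I, |k x - k y| ≤ L * |x - y|)
    (hd : ∀ x ∈ I, HasDerivWithinAt h (ρ x) I x) (hpos : ∀ x ∈ I, 0 < ρ x) {m : ℕ}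
    (hρ : Cls β m ρ) : Cls β (m + 1) k := by
  have hkd : ∀ x ∈ I, HasDerivWithinAt k (ρ (k x))⁻¹ I x := fun x hx =>
    hasDerivWithinAt_inverse hx hk hr (continuousOn_of_lipschitz hL) (hd _ (hk hx))
      (hpos _ (hk hx)).ne'
  have key : ∀ n ≤ m, Cls β n k → Cls β (n + 1) k := fun n hn hkn =>
    ⟨_, hkd, ((hρ.of_le hβ hn).comp hβ hkn hk hL).inv hβ fun x hx => hpos _ (hk hx)⟩
  have : ∀ n ≤ m, Cls β n k := by
    intro n
    induction n with
    | zero => exact fun _ => base_of_lipschitz hβ hL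
    | succ n ih => exact fun hn => key n (by omega) (ih (by omega))
  exact key m le_rfl (this m le_rfl)

/-! ### The cohomological equation `u = a + b * u ∘ g` -/

/-- The terms of the series solving `u = a + b * u ∘ g`. -/
def cohomTerm (a b g : ℝ → ℝ) : ℕ → ℝ → ℝ
  | 0 => a
  | n + 1 => fun x => b x * cohomTerm a b g n (g x)

/-- Sum of a uniformly convergent Neumann series. The geometric bound is a hypothesis because it has
two sources: `|b| ≤ q < 1`, or `b = 1` with a Hölder `a` vanishing at the attracting fixed point. -/
theorem exists_cohom_solution {a b g : ℝ → ℝ} (ha : ContinuousOn a I) (hb : ContinuousOn b I)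
    (hg : ContinuousOn g I) (hm : MapsTo g I I) {q C : ℝ} (hq0 : 0 ≤ q) (hq : q < 1)
    (h : ∀ n, ∀ x ∈ I, |cohomTerm a b g n x| ≤ C * q ^ n) :
    ∃ u : ℝ → ℝ, ContinuousOn u I ∧ ∀ x ∈ I, u x = a x + b x * u (g x) := by
  have hs : Summable fun n : ℕ => C * q ^ n := (summable_geometric_of_lt_one hq0 hq).mul_left C
  have hc : ∀ n, ContinuousOn (cohomTerm a b g n) I := by
    intro n
    induction n with
    | zero => exact ha
    | succ n ih => exact hb.mul (ih.comp hg hm)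
  have hsx : ∀ x ∈ I, Summable fun n => cohomTerm a b g n x := fun x hx =>
    Summable.of_norm_bounded hs fun n => h n x hx
  refine ⟨fun x => ∑' n, cohomTerm a b g n x, continuousOn_tsum hc hs h, fun x hx => ?_⟩
  simp only
  rw [(hsx x hx).tsum_eq_zero_add]
  simp only [cohomTerm]
  rw [tsum_mul_left]

theorem exists_cohom_solution_of_contracting {a b g : ℝ → ℝ} (ha : ContinuousOn a I)
    (hb : ContinuousOn b I) (hg : ContinuousOn g I) (hm : MapsTo g I I) {q : ℝ} (hq0 : 0 ≤ q)
    (hq : q < 1) (hbq : ∀ x ∈ I, |b x| ≤ q) :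
    ∃ u : ℝ → ℝ, ContinuousOn u I ∧ ∀ x ∈ I, u x = a x + b x * u (g x) := by
  obtain ⟨C, hC0, hC⟩ := exists_abs_bound ha
  refine exists_cohom_solution (C := C) ha hb hg hm hq0 hq fun n => ?_
  induction n with
  | zero => intro x hx; simpa [cohomTerm] using hC x hx
  | succ n ih =>
    intro x hx
    simp only [cohomTerm]
    rw [abs_mul, pow_succ, ← mul_assoc, mul_comm]
    exact mul_le_mul (ih _ (hm hx)) (hbq x hx) (abs_nonneg _) (by positivity)

/-! ### Regularity of solutions of the cohomological equation -/

section Regularity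

variable {β : Option ℝ} {g : ℝ → ℝ}

theorem abs_deriv_le_of_lipschitz {g : ℝ → ℝ} {M d x : ℝ} (hx : x ∈ I)
    (hL : ∀ x ∈ I, ∀ y ∈ I, |g x - g y| ≤ M * |x - y|) (hd : HasDerivWithinAt g d I x) :
    |d| ≤ M := by
  rw [hasDerivWithinAt_iff_tendsto_slope] at hd
  have : (𝓝[I \ {x}] x).NeBot := by
    have := (uniqueDiffOn_Icc (zero_lt_one (α := ℝ)) x hx)
    rw [uniqueDiffWithinAt_iff_accPt, accPt_principal_iff_nhdsWithin] at this
    exact this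
  refine le_of_tendsto hd.abs ?_
  filter_upwards [self_mem_nhdsWithin] with y hy
  have hne : 0 < |y - x| := abs_pos.2 (sub_ne_zero.2 hy.2)
  rw [slope_def_field, abs_div, div_le_iff₀ hne]
  exact hL y hy.1 x hx

/-- The Hölder constant `K` is the fixed point of `K ↦ A + B * C + q * K`. Using the equation `n`
times leaves an error `q ^ n * (2 * C)`, which vanishes in the limit. -/
theorem base_cohom_of_contracting (hβ : ValidExp β) {a b u : ℝ → ℝ} {q : ℝ} (hq0 : 0 ≤ q)
    (hq : q < 1) (hbq : ∀ x ∈ I, |b x| ≤ q) (hm : MapsTo g I I)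
    (hL : ∀ x ∈ I, ∀ y ∈ I, |g x - g y| ≤ |x - y|)
    (hu : ContinuousOn u I) (he : ∀ x ∈ I, u x = a x + b x * u (g x))
    (ha : Base β a) (hb : Base β b) : Base β u := by
  cases β with
  | none => exact hu
  | some α =>
    obtain ⟨A, hA0, hA⟩ := ha.holder_nonneg
    obtain ⟨B, hB0, hB⟩ := hb.holder_nonneg
    obtain ⟨C, hC0, hC⟩ := exists_abs_bound hu
    set K := (A + B * C) / (1 - q) with hK
    have hK0 : 0 ≤ K := div_nonneg (by positivity) (by linarith)
    have hKe : A + B * C + q * K = K := by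
      rw [hK]; field_simp [(by linarith : (1 - q) ≠ 0)]; ring
    have key : ∀ n : ℕ, ∀ x ∈ I, ∀ y ∈ I, |u x - u y| ≤ K * |x - y| ^ α + q ^ n * (2 * C) := by
      intro n
      induction n with
      | zero =>
        intro x hx y hy
        have h1 := abs_sub (u x) (u y)
        have h2 := hC x hx
        have h3 := hC y hy
        have : 0 ≤ K * |x - y| ^ α := by positivity
        simp only [pow_zero]
        linarith
      | succ n ih =>
        intro x hx y hy
        have hg : |g x - g y| ^ α ≤ |x - y| ^ α :=
          Real.rpow_le_rpow (abs_nonneg _) (hL x hx y hy) hβ.1.le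
        have h1 : |u (g x) - u (g y)| ≤ K * |x - y| ^ α + q ^ n * (2 * C) :=
          (ih _ (hm hx) _ (hm hy)).trans (by gcongr)
        have e : u x - u y = (a x - a y) + (b x - b y) * u (g x) + b y * (u (g x) - u (g y)) := by
          rw [he x hx, he y hy]; ring
        rw [e]
        calc |a x - a y + (b x - b y) * u (g x) + b y * (u (g x) - u (g y))|
            ≤ |a x - a y| + |b x - b y| * |u (g x)| + |b y| * |u (g x) - u (g y)| := by
              rw [← abs_mul, ← abs_mul]; exact abs_add_three _ _ _
          _ ≤ A * |x - y| ^ α + (B * |x - y| ^ α) * C + q * (K * |x - y| ^ α + q ^ n * (2 * C)) := by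
              gcongr
              · exact hA x hx y hy
              · exact hB x hx y hy
              · exact hC _ (hm hx)
              · exact hbq y hy
          _ = (A + B * C + q * K) * |x - y| ^ α + q ^ (n + 1) * (2 * C) := by ring
          _ = _ := by rw [hKe]
    refine ⟨K, fun x hx y hy => ?_⟩
    have ht : Tendsto (fun n : ℕ => K * |x - y| ^ α + q ^ n * (2 * C)) atTop
        (𝓝 (K * |x - y| ^ α + 0 * (2 * C))) :=
      ((tendsto_pow_atTop_nhds_zero_of_lt_one hq0 hq).mul_const _).const_add _
    rw [zero_mul, add_zero] at ht
    exact ge_of_tendsto' ht fun n => key n x hx y hy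

/-- Iteration of `u ↦ a + b * u ∘ g` from zero, with the formal derivatives in the second
component. -/
def cohomIter (a b g a' b' g' : ℝ → ℝ) : ℕ → (ℝ → ℝ) × (ℝ → ℝ)
  | 0 => (fun _ => 0, fun _ => 0)
  | n + 1 =>
    (fun x => a x + b x * (cohomIter a b g a' b' g' n).1 (g x),
      fun x => a' x + (b' x * (cohomIter a b g a' b' g' n).1 (g x) +
        b x * ((cohomIter a b g a' b' g' n).2 (g x) * g' x)))

theorem tendsto_zero_of_le_geometric {e : ℕ → ℝ} {q C : ℝ} (hq0 : 0 < q) (hq : q < 1)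
    (h : ∀ n, e (n + 1) ≤ C * q ^ n + q * e n) (he : ∀ n, 0 ≤ e n) :
    Tendsto e atTop (𝓝 0) := by
  have key : ∀ n : ℕ, e n ≤ (e 0 + n * (C / q)) * q ^ n := by
    intro n
    induction n with
    | zero => simp
    | succ n ih =>
      calc e (n + 1) ≤ C * q ^ n + q * ((e 0 + n * (C / q)) * q ^ n) := by
            refine (h n).trans ?_; gcongr
        _ = (e 0 + ((n + 1 : ℕ) : ℝ) * (C / q)) * q ^ (n + 1) := by
            push_cast; field_simp; ring
  have h1 : Tendsto (fun n : ℕ => e 0 * q ^ n + (C / q) * ((n : ℝ) * q ^ n)) atTop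
      (𝓝 (e 0 * 0 + (C / q) * 0)) :=
    ((tendsto_pow_atTop_nhds_zero_of_lt_one hq0.le hq).const_mul _).add
      ((tendsto_self_mul_const_pow_of_lt_one hq0.le hq).const_mul _)
  rw [mul_zero, mul_zero, add_zero] at h1
  exact squeeze_zero he (fun n => (key n).trans (by ring_nf; rfl)) h1

/-- A continuous solution of `u = a + b * u ∘ g` is differentiable if the data are, its derivative
solving the differentiated equation. -/
theorem cohom_hasDeriv {a b a' b' g' u v : ℝ → ℝ} {q : ℝ} (hq0 : 0 < q) (hq : q < 1)
    (hbq : ∀ x ∈ I, |b x| ≤ q) (hg1 : ∀ x ∈ I, |g' x| ≤ 1) (hm : MapsTo g I I)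
    (ha : ∀ x ∈ I, HasDerivWithinAt a (a' x) I x) (hb : ∀ x ∈ I, HasDerivWithinAt b (b' x) I x)
    (hg : ∀ x ∈ I, HasDerivWithinAt g (g' x) I x)
    (hb' : ContinuousOn b' I) (hu : ContinuousOn u I) (hv : ContinuousOn v I)
    (hue : ∀ x ∈ I, u x = a x + b x * u (g x))
    (hve : ∀ x ∈ I, v x = (a' x + b' x * u (g x)) + b x * g' x * v (g x)) :
    ∀ x ∈ I, HasDerivWithinAt u (v x) I x := by
  set U := cohomIter a b g a' b' g' with hU
  obtain ⟨Cu, hCu0, hCu⟩ := exists_abs_bound hu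
  obtain ⟨Cv, hCv0, hCv⟩ := exists_abs_bound hv
  obtain ⟨Cb, hCb0, hCb⟩ := exists_abs_bound hb'
  have hder : ∀ n, ∀ x ∈ I, HasDerivWithinAt (U n).1 ((U n).2 x) I x := by
    intro n
    induction n with
    | zero => exact fun x _ => hasDerivWithinAt_const x I 0
    | succ n ih =>
      intro x hx
      exact (ha x hx).add ((hb x hx).mul ((ih (g x) (hm hx)).comp x (hg x hx) hm))
  have hUu : ∀ n, ∀ x ∈ I, |(U n).1 x - u x| ≤ Cu * q ^ n := by
    intro n
    induction n with
    | zero => intro x hx; simpa [hU, cohomIter] using hCu x hx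
    | succ n ih =>
      intro x hx
      have : (U (n + 1)).1 x - u x = b x * ((U n).1 (g x) - u (g x)) := by
        rw [hue x hx]; simp only [hU, cohomIter]; ring
      rw [this, abs_mul, pow_succ, ← mul_assoc, mul_comm]
      exact mul_le_mul (ih _ (hm hx)) (hbq x hx) (abs_nonneg _) (by positivity)
  -- Uniform majorant of the error of the formal derivatives; its source term is the error `Cu * q ^
  -- n` of the functions themselves.
  let E : ℕ → ℝ := fun n => Nat.rec Cv (fun n e => Cb * Cu * q ^ n + q * e) n
  have hE0 : ∀ n, 0 ≤ E n := by
    intro n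
    induction n with
    | zero => exact hCv0
    | succ n ih => exact add_nonneg (by positivity) (mul_nonneg hq0.le ih)
  have hUv : ∀ n, ∀ x ∈ I, |(U n).2 x - v x| ≤ E n := by
    intro n
    induction n with
    | zero => intro x hx; simpa [hU, cohomIter, E] using hCv x hx
    | succ n ih =>
      intro x hx
      have : (U (n + 1)).2 x - v x = b' x * ((U n).1 (g x) - u (g x)) +
          (b x * g' x) * ((U n).2 (g x) - v (g x)) := by
        rw [hve x hx]; simp only [hU, cohomIter]; ring
      rw [this]
      have hbg : |b x * g' x| ≤ q := by
        rw [abs_mul, ← mul_one q]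
        exact mul_le_mul (hbq x hx) (hg1 x hx) (abs_nonneg _) hq0.le
      calc |b' x * ((U n).1 (g x) - u (g x)) + (b x * g' x) * ((U n).2 (g x) - v (g x))|
          ≤ |b' x| * |(U n).1 (g x) - u (g x)| + |b x * g' x| * |(U n).2 (g x) - v (g x)| := by
            rw [← abs_mul, ← abs_mul]; exact abs_add_le _ _
        _ ≤ Cb * (Cu * q ^ n) + q * E n := by
            gcongr
            · exact hCb x hx
            · exact hUu n _ (hm hx)
            · exact ih _ (hm hx)
        _ = Cb * Cu * q ^ n + q * E n := by ring
  have hE : Tendsto E atTop (𝓝 0) :=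
    tendsto_zero_of_le_geometric hq0 hq (C := Cb * Cu) (fun n => le_rfl) hE0
  -- The iterates converge to `u` and their derivatives uniformly to `v`, so `u` equals the
  -- primitive of `v` with the same value at `0`.
  obtain ⟨V, hV0, hV⟩ := exists_primitive hv (u 0)
  have huV : ∀ x ∈ I, u x = V x := by
    intro x hx
    have hlim : ∀ y ∈ I, Tendsto (fun n => (U n).1 y) atTop (𝓝 (u y)) := by
      intro y hy
      rw [tendsto_iff_dist_tendsto_zero]
      refine squeeze_zero (fun _ => dist_nonneg) (fun n => hUu n y hy) ?_
      simpa using (tendsto_pow_atTop_nhds_zero_of_lt_one hq0.le hq).const_mul Cu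
    have h1 : ∀ n, |((U n).1 x - V x) - ((U n).1 0 - V 0)| ≤ E n := fun n =>
      (lipschitz_of_deriv_le (f := fun x => (U n).1 x - V x) (f' := fun x => (U n).2 x - v x)
        (fun y hy => (hder n y hy).sub (hV y hy)) (hUv n) x hx 0 (by simp)).trans
        (mul_le_of_le_one_right (hE0 n) (abs_sub_le_one hx (by simp)))
    have h2 := (((hlim x hx).sub_const (V x)).sub ((hlim 0 (by simp)).sub_const (V 0))).abs
    have h3 := le_of_tendsto_of_tendsto' h2 hE h1
    have h4 := abs_nonpos_iff.1 h3
    rw [hV0] at h4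
    linarith
  exact fun x hx => (hV x hx).congr huV (huV x hx)

/-- The derivative solves an equation of the same kind, with `b * g'` in place of `b`, which is
still bounded by `q`. Its inhomogeneity contains `u ∘ g`, so `u` is first shown to have the lower
regularity. -/
theorem cls_cohom_of_contracting (hβ : ValidExp β) {a b u : ℝ → ℝ} {m : ℕ} {q : ℝ} (hq0 : 0 < q)
    (hq : q < 1) (hbq : ∀ x ∈ I, |b x| ≤ q) (hm : MapsTo g I I)
    (hL : ∀ x ∈ I, ∀ y ∈ I, |g x - g y| ≤ 1 * |x - y|) (hg : Cls β (m + 1) g)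
    (hu : ContinuousOn u I) (he : ∀ x ∈ I, u x = a x + b x * u (g x))
    (ha : Cls β m a) (hb : Cls β m b) : Cls β m u := by
  induction m generalizing a b u with
  | zero =>
    refine base_cohom_of_contracting hβ hq0.le hq hbq hm (fun x hx y hy => ?_) hu he ha hb
    simpa using hL x hx y hy
  | succ m ih =>
    have hum : Cls β m u := ih hbq (hg.of_succ hβ) hu he (ha.of_succ hβ) (hb.of_succ hβ)
    have hgm := (hg.of_succ hβ).of_succ hβ
    have hbm := hb.of_succ hβ
    have hg2 := hg.of_succ hβ
    obtain ⟨a', ha', ham⟩ := ha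
    obtain ⟨b', hb', hbm'⟩ := hb
    obtain ⟨g', hg', hgm'⟩ := hg2
    have hg1 : ∀ x ∈ I, |g' x| ≤ 1 := fun x hx =>
      abs_deriv_le_of_lipschitz hx hL (hg' x hx)
    have hA : Cls β m fun x => a' x + b' x * u (g x) :=
      ham.add hβ (hbm'.mul hβ (hum.comp hβ hgm hm hL))
    have hB : Cls β m fun x => b x * g' x := hbm.mul hβ hgm'
    have hBq : ∀ x ∈ I, |b x * g' x| ≤ q := fun x hx => by
      rw [abs_mul, ← mul_one q]
      exact mul_le_mul (hbq x hx) (hg1 x hx) (abs_nonneg _) hq0.le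
    obtain ⟨v, hv, hve⟩ := exists_cohom_solution_of_contracting (hA.continuousOn hβ)
      (hB.continuousOn hβ) (hgm.continuousOn hβ) hm hq0.le hq hBq
    exact ⟨v, cohom_hasDeriv hq0 hq hbq hg1 hm ha' hb' hg' (hbm'.continuousOn hβ) hu hv he hve,
      ih hBq (hg.of_succ hβ) hv hve hA hB⟩

/-- Existence for `ψ = φ + ψ ∘ g`, where `g` contracts to `0` and `φ 0 = 0`. -/
theorem exists_coboundary {φ : ℝ → ℝ} {α M : ℝ} (h0 : 0 < α) (h1 : α ≤ 1) (hM0 : 0 ≤ M)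
    (hM : M < 1) (hm : MapsTo g I I) (hL : ∀ x ∈ I, ∀ y ∈ I, |g x - g y| ≤ M * |x - y|)
    (hg0 : g 0 = 0) (hφ : Base (some α) φ) (hφ0 : φ 0 = 0) :
    ∃ ψ : ℝ → ℝ, ContinuousOn ψ I ∧ ∀ x ∈ I, ψ x = φ x + ψ (g x) := by
  obtain ⟨A, hA0, hA⟩ := hφ.holder_nonneg
  have key : ∀ n, ∀ x ∈ I, |cohomTerm φ (fun _ => 1) g n x| ≤ A * |x| ^ α * (M ^ α) ^ n := by
    intro n
    induction n with
    | zero => intro x hx; simpa [cohomTerm, hφ0] using hA x hx 0 (by simp)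
    | succ n ih =>
      intro x hx
      simp only [cohomTerm, one_mul]
      refine (ih _ (hm hx)).trans ?_
      have : |g x| ^ α ≤ M ^ α * |x| ^ α := by
        rw [← Real.mul_rpow hM0 (abs_nonneg _)]
        refine Real.rpow_le_rpow (abs_nonneg _) ?_ h0.le
        simpa [hg0] using hL x hx 0 (by simp)
      calc A * |g x| ^ α * (M ^ α) ^ n ≤ A * (M ^ α * |x| ^ α) * (M ^ α) ^ n := by gcongr
        _ = _ := by ring
  obtain ⟨u, hu, he⟩ := exists_cohom_solution (a := φ) (b := fun _ => 1) (C := A)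
    (Base.continuousOn (β := some α) ⟨h0, h1⟩ hφ) continuousOn_const
    (continuousOn_of_lipschitz hL) hm (Real.rpow_nonneg hM0 α) (Real.rpow_lt_one hM0 hM h0)
    (fun n x hx => (key n x hx).trans (by
      have hx1 : |x| ^ α ≤ 1 := Real.rpow_le_one (abs_nonneg _)
        (by simpa using abs_sub_le_one hx (y := 0) (by simp)) h0.le
      have : A * |x| ^ α ≤ A := mul_le_of_le_one_right hA0 hx1
      gcongr))
  exact ⟨u, hu, fun x hx => by simpa using he x hx⟩

/-- There is no factor `b` to contract here; the gain `M ^ α < 1` comes from the contraction of `g`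
through the exponent. The induction is on the number of steps bringing two points within the
distance where uniform continuity of `ψ` gives `ε`. -/
theorem base_coboundary (hβ : ValidExp β) {φ ψ : ℝ → ℝ} {M : ℝ} (hM0 : 0 ≤ M)
    (hM : M < 1) (hm : MapsTo g I I) (hL : ∀ x ∈ I, ∀ y ∈ I, |g x - g y| ≤ M * |x - y|)
    (hψ : ContinuousOn ψ I) (he : ∀ x ∈ I, ψ x = φ x + ψ (g x)) (hφ : Base β φ) : Base β ψ := by
  cases β with
  | none => exact hψ
  | some α =>
    obtain ⟨A, hA0, hA⟩ := hφ.holder_nonneg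
    have hMα : M ^ α < 1 := Real.rpow_lt_one hM0 hM hβ.1
    set K := A / (1 - M ^ α) with hK
    have hK0 : 0 ≤ K := div_nonneg hA0 (by linarith)
    have hKe : A + M ^ α * K = K := by
      rw [hK]; field_simp [(by linarith : (1 - M ^ α) ≠ 0)]; ring
    refine ⟨K, fun x hx y hy => le_of_forall_pos_le_add fun ε hε => ?_⟩
    obtain ⟨δ, hδ, hunif⟩ := Metric.uniformContinuousOn_iff.1
      (isCompact_Icc.uniformContinuousOn_of_continuous hψ) ε hε
    have key : ∀ n : ℕ, ∀ x ∈ I, ∀ y ∈ I, M ^ n * |x - y| < δ →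
        |ψ x - ψ y| ≤ K * |x - y| ^ α + ε := by
      intro n
      induction n with
      | zero =>
        intro x hx y hy h
        have h1 : |ψ x - ψ y| < ε := hunif x hx y hy (by simpa [Real.dist_eq] using h)
        have : 0 ≤ K * |x - y| ^ α := by positivity
        linarith
      | succ n ih =>
        intro x hx y hy h
        have hxy := hL x hx y hy
        have h1 := ih _ (hm hx) _ (hm hy) (lt_of_le_of_lt (by
          calc M ^ n * |g x - g y| ≤ M ^ n * (M * |x - y|) := by gcongr
            _ = M ^ (n + 1) * |x - y| := by ring) h)
        have h2 : |g x - g y| ^ α ≤ M ^ α * |x - y| ^ α := by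
          rw [← Real.mul_rpow hM0 (abs_nonneg _)]
          exact Real.rpow_le_rpow (abs_nonneg _) hxy hβ.1.le
        have e : ψ x - ψ y = (φ x - φ y) + (ψ (g x) - ψ (g y)) := by
          rw [he x hx, he y hy]; ring
        rw [e]
        calc |φ x - φ y + (ψ (g x) - ψ (g y))|
            ≤ A * |x - y| ^ α + (K * |g x - g y| ^ α + ε) :=
              (abs_add_le _ _).trans (add_le_add (hA x hx y hy) h1)
          _ ≤ A * |x - y| ^ α + (K * (M ^ α * |x - y| ^ α) + ε) := by gcongr
          _ = (A + M ^ α * K) * |x - y| ^ α + ε := by ring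
          _ = _ := by rw [hKe]
    have ht : Tendsto (fun n : ℕ => M ^ n * |x - y|) atTop (𝓝 (0 * |x - y|)) :=
      (tendsto_pow_atTop_nhds_zero_of_lt_one hM0 hM).mul_const _
    rw [zero_mul] at ht
    obtain ⟨n, hn⟩ := (ht.eventually (gt_mem_nhds hδ)).exists
    exact key n x hx y hy hn

theorem tendsto_iterate_zero {M : ℝ} (hM0 : 0 ≤ M) (hM : M < 1) (hm : MapsTo g I I)
    (hL : ∀ x ∈ I, ∀ y ∈ I, |g x - g y| ≤ M * |x - y|) (hg0 : g 0 = 0) {x : ℝ} (hx : x ∈ I) :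
    Tendsto (fun n => g^[n] x) atTop (𝓝[I] 0) := by
  have hI : ∀ n, g^[n] x ∈ I := fun n => hm.iterate n hx
  have hb : ∀ n, |g^[n] x| ≤ M ^ n := by
    intro n
    induction n with
    | zero => simpa using abs_sub_le_one hx (y := 0) (by simp)
    | succ n ih =>
      rw [Function.iterate_succ_apply']
      have := hL _ (hI n) 0 (by simp)
      rw [hg0, sub_zero, sub_zero] at this
      rw [pow_succ']
      exact this.trans (by gcongr)
  refine tendsto_nhdsWithin_iff.2 ⟨?_, Eventually.of_forall hI⟩
  exact squeeze_zero_norm hb (tendsto_pow_atTop_nhds_zero_of_lt_one hM0 hM)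

/-- Formal differentiation gives `v = φ' + g' * v ∘ g`, which is contracting and hence has a
solution of the right class. Its primitive solves the original equation, and continuous solutions
are unique up to a constant. -/
theorem cls_coboundary (hβ : ValidExp β) {φ ψ : ℝ → ℝ} {m : ℕ} {M : ℝ} (hM0 : 0 < M)
    (hM : M < 1) (hm : MapsTo g I I) (hL : ∀ x ∈ I, ∀ y ∈ I, |g x - g y| ≤ M * |x - y|)
    (hg0 : g 0 = 0) (hg : Cls β (m + 1) g) (hψ : ContinuousOn ψ I)
    (he : ∀ x ∈ I, ψ x = φ x + ψ (g x)) (hφ : Cls β m φ) : Cls β m ψ := by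
  cases m with
  | zero => exact base_coboundary hβ hM0.le hM hm hL hψ he hφ
  | succ m =>
    have hgm := hg.of_succ hβ
    have hg2 := hgm
    obtain ⟨φ', hφ', hφm⟩ := hφ
    obtain ⟨g', hg', hgm'⟩ := hg2
    have hgM : ∀ x ∈ I, |g' x| ≤ M := fun x hx =>
      abs_deriv_le_of_lipschitz hx hL (hg' x hx)
    have hL1 : ∀ x ∈ I, ∀ y ∈ I, |g x - g y| ≤ 1 * |x - y| := fun x hx y hy =>
      (hL x hx y hy).trans (by gcongr)
    obtain ⟨v, hv, hve⟩ := exists_cohom_solution_of_contracting (hφm.continuousOn hβ)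
      (hgm'.continuousOn hβ) (hgm.continuousOn hβ) hm hM0.le hM hgM
    have hvm : Cls β m v := cls_cohom_of_contracting hβ hM0 hM hgM hm hL1 hgm hv hve hφm hgm'
    obtain ⟨V, hV0, hV⟩ := exists_primitive hv (ψ 0)
    have h00 : (0 : ℝ) ∈ I := by simp
    have hφ0 : φ 0 = 0 := by
      have := he 0 h00
      rw [hg0] at this
      linarith
    have hVe : ∀ x ∈ I, V x = φ x + V (g x) := by
      refine eq_of_deriv_eq hV (fun x hx => ?_) (by rw [hφ0, hg0, zero_add])
      rw [hve x hx, mul_comm]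
      exact (hφ' x hx).add ((hV (g x) (hm hx)).comp x (hg' x hx) hm)
    have hVc : ContinuousOn V I := fun x hx => (hV x hx).continuousWithinAt
    have hδ : ∀ x ∈ I, ψ x = V x := by
      intro x hx
      -- The difference of two solutions is `g`-invariant, so its value at `x` is its limit along
      -- the orbit, namely the value at `0`.
      have hit : ∀ n, ψ (g^[n] x) - V (g^[n] x) = ψ x - V x := by
        intro n
        induction n with
        | zero => rfl
        | succ n ih =>
          rw [← ih, Function.iterate_succ_apply', he _ (hm.iterate n hx), hVe _ (hm.iterate n hx)]
          ring
      have hlim := ((hψ 0 h00).tendsto.sub (hVc 0 h00).tendsto).comp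
        (tendsto_iterate_zero hM0.le hM hm hL hg0 hx)
      have h2 : Tendsto (fun _ : ℕ => ψ x - V x) atTop (𝓝 (ψ 0 - V 0)) :=
        hlim.congr hit
      have := tendsto_nhds_unique h2 tendsto_const_nhds
      rw [hV0, sub_self] at this
      linarith
    exact Cls.congr (m := m + 1) ⟨v, hV, hvm⟩ hδ

end Regularity

/-! ### Cylinder maps -/

theorem wordMap_mapsTo {g : Fin 2 → ℝ → ℝ} (hm : ∀ i, MapsTo (g i) I I) (w : List (Fin 2)) :
    MapsTo (wordMap g w) I I := by
  induction w with
  | nil => exact mapsTo_id I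
  | cons i w ih => exact (hm i).comp ih

/-- The derivative of `wordMap g w` given by the chain rule, where `d i` is the derivative of
`g i`. -/
def wordDeriv (g d : Fin 2 → ℝ → ℝ) : List (Fin 2) → ℝ → ℝ
  | [], _ => 1
  | i :: w, x => d i (wordMap g w x) * wordDeriv g d w x

theorem hasDerivWithinAt_wordMap {g d : Fin 2 → ℝ → ℝ} (hm : ∀ i, MapsTo (g i) I I)
    (hd : ∀ i, ∀ x ∈ I, HasDerivWithinAt (g i) (d i x) I x) (w : List (Fin 2)) :
    ∀ x ∈ I, HasDerivWithinAt (wordMap g w) (wordDeriv g d w x) I x := by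
  induction w with
  | nil => exact fun x _ => hasDerivWithinAt_id x I
  | cons i w ih =>
    exact fun x hx => (hd i _ (wordMap_mapsTo hm w hx)).comp x (ih x hx) (wordMap_mapsTo hm w)

theorem continuousOn_wordMap {g : Fin 2 → ℝ → ℝ} (hm : ∀ i, MapsTo (g i) I I)
    (hg : ∀ i, ContinuousOn (g i) I) (w : List (Fin 2)) : ContinuousOn (wordMap g w) I := by
  induction w with
  | nil => exact continuousOn_id
  | cons i w ih => exact (hg i).comp ih (wordMap_mapsTo hm w)

theorem continuousOn_wordDeriv {g d : Fin 2 → ℝ → ℝ} (hm : ∀ i, MapsTo (g i) I I)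
    (hg : ∀ i, ContinuousOn (g i) I) (hd : ∀ i, ContinuousOn (d i) I) (w : List (Fin 2)) :
    ContinuousOn (wordDeriv g d w) I := by
  induction w with
  | nil => exact continuousOn_const
  | cons i w ih =>
    exact ((hd i).comp (continuousOn_wordMap hm hg w) (wordMap_mapsTo hm w)).mul ih

/-- The closure of the orbit of `0` under the cylinder maps. -/
def orbitClosure (g : Fin 2 → ℝ → ℝ) : Set ℝ := closure (range fun w => wordMap g w 0)

theorem zero_mem_orbitClosure (g : Fin 2 → ℝ → ℝ) : (0 : ℝ) ∈ orbitClosure g :=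
  subset_closure ⟨[], rfl⟩

theorem orbitClosure_subset {g : Fin 2 → ℝ → ℝ} (hm : ∀ i, MapsTo (g i) I I) :
    orbitClosure g ⊆ I := by
  refine closure_minimal ?_ isClosed_Icc
  rintro _ ⟨w, rfl⟩
  exact wordMap_mapsTo hm w (by simp)

theorem isAttractor_orbitClosure {g : Fin 2 → ℝ → ℝ} (hm : ∀ i, MapsTo (g i) I I)
    (hg : ∀ i, ContinuousOn (g i) I) (h0 : g 0 0 = 0) : IsAttractor g (orbitClosure g) := by
  have hsub := orbitClosure_subset hm
  have hcomp : IsCompact (orbitClosure g) := isCompact_Icc.of_isClosed_subset isClosed_closure hsub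
  refine ⟨hsub, ⟨0, zero_mem_orbitClosure g⟩, hcomp, Subset.antisymm ?_ ?_⟩
  · refine closure_minimal ?_ (isClosed_iUnion_of_finite fun i =>
      (hcomp.image_of_continuousOn ((hg i).mono hsub)).isClosed)
    rintro _ ⟨w, rfl⟩
    cases w with
    | nil => exact mem_iUnion.2 ⟨0, 0, zero_mem_orbitClosure g, h0⟩
    | cons i w => exact mem_iUnion.2 ⟨i, _, subset_closure ⟨w, rfl⟩, rfl⟩
  · refine iUnion_subset fun i => ?_
    have h1 := ContinuousOn.image_closure (f := g i) (s := range fun w => wordMap g w 0)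
      ((hg i).mono hsub)
    refine h1.trans (closure_mono ?_)
    rintro _ ⟨_, ⟨w, rfl⟩, rfl⟩
    exact ⟨i :: w, rfl⟩

theorem maps_orbitClosure {g : Fin 2 → ℝ → ℝ} (hm : ∀ i, MapsTo (g i) I I)
    (hg : ∀ i, ContinuousOn (g i) I) (h0 : g 0 0 = 0) (i : Fin 2) :
    MapsTo (g i) (orbitClosure g) (orbitClosure g) := by
  intro x hx
  rw [(isAttractor_orbitClosure hm hg h0).eq_iUnion]
  exact mem_iUnion.2 ⟨i, x, hx, rfl⟩

/-! ### Consequences of the Livsic condition -/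

section Livsic

variable {g d : Fin 2 → ℝ → ℝ} {ρ : ℝ → ℝ} {lam M : ℝ}

/-- If `ρ` linearizes `g 0`, the Livsic condition forces the density `ρ` to linearize every cylinder
map at `0`. -/
theorem density_wordMap_zero (hlam : 0 < lam) (hL : LivsicCondition g lam)
    (hm : ∀ i, MapsTo (g i) I I) (hd : ∀ i, ∀ x ∈ I, HasDerivWithinAt (g i) (d i x) I x)
    (hdc : ∀ i, ContinuousOn (d i) I) (hM0 : 0 ≤ M) (hM : M < 1)
    (hLip : ∀ x ∈ I, ∀ y ∈ I, |g 0 x - g 0 y| ≤ M * |x - y|) (h0 : g 0 0 = 0)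
    (hρ : ContinuousOn ρ I) (hρ0 : ∀ x ∈ I, ρ (g 0 x) * d 0 x = lam * ρ x) (w : List (Fin 2)) :
    ρ (wordMap g w 0) * wordDeriv g d w 0 = lam ^ w.length * ρ 0 := by
  have hg : ∀ i, ContinuousOn (g i) I := fun i x hx => (hd i x hx).continuousWithinAt
  -- Prefixing zeros drives the fixed point of the cylinder map to `0`, while `hρ0` makes each added
  -- letter contribute exactly a factor `lam`.
  let z : ℕ → List (Fin 2) := fun n => List.replicate n 0 ++ w
  have hzs : ∀ n, z (n + 1) = 0 :: z n := fun n => by simp [z, List.replicate_succ]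
  have hzρ : ∀ n, ∀ x ∈ I, ρ (wordMap g (z n) x) * wordDeriv g d (z n) x =
      lam ^ n * (ρ (wordMap g w x) * wordDeriv g d w x) := by
    intro n x hx
    induction n with
    | zero => simp [z]
    | succ n ih =>
      rw [hzs]
      simp only [wordMap, wordDeriv, Function.comp_apply]
      rw [← mul_assoc, hρ0 _ (wordMap_mapsTo hm _ hx), mul_assoc, ih]
      ring
  have hzb : ∀ n, ∀ x ∈ I, |wordMap g (z n) x| ≤ M ^ n := by
    intro n x hx
    induction n with
    | zero => simpa [z] using abs_sub_le_one (wordMap_mapsTo hm w hx) (y := 0) (by simp)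
    | succ n ih =>
      rw [hzs]
      have := hLip _ (wordMap_mapsTo hm (z n) hx) 0 (by simp)
      rw [h0, sub_zero, sub_zero] at this
      rw [pow_succ']
      exact this.trans (by gcongr)
  have hfix : ∀ n, ∃ y ∈ I, wordMap g (z n) y = y := by
    intro n
    obtain ⟨y, hy, hf⟩ := exists_mem_Icc_isFixedPt_of_mapsTo (continuousOn_wordMap hm hg (z n))
      zero_le_one (wordMap_mapsTo hm (z n))
    exact ⟨y, hy, hf⟩
  choose y hyI hy using hfix
  have hrel : ∀ n, ρ (wordMap g w (y n)) * wordDeriv g d w (y n) = lam ^ w.length * ρ (y n) := by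
    intro n
    have h1 := hL (z n) (y n) (hyI n) (hy n)
    rw [HasDerivWithinAt.derivWithin_I (hyI n) (hasDerivWithinAt_wordMap hm hd _ _ (hyI n))] at h1
    have h2 := hzρ n (y n) (hyI n)
    have hlen : (z n).length = n + w.length := by simp [z]
    rw [h1, hy n, hlen, pow_add] at h2
    have h3 : lam ^ n ≠ 0 := (pow_pos hlam n).ne'
    apply mul_left_cancel₀ h3
    rw [← h2]; ring
  have hy0 : Tendsto y atTop (𝓝[I] 0) := by
    refine tendsto_nhdsWithin_iff.2 ⟨?_, Eventually.of_forall hyI⟩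
    refine squeeze_zero_norm (fun n => ?_) (tendsto_pow_atTop_nhds_zero_of_lt_one hM0 hM)
    rw [← hy n]
    exact hzb n _ (hyI n)
  have h00 : (0 : ℝ) ∈ I := by simp
  have hl : ContinuousOn (fun x => ρ (wordMap g w x) * wordDeriv g d w x) I :=
    (hρ.comp (continuousOn_wordMap hm hg w) (wordMap_mapsTo hm w)).mul
      (continuousOn_wordDeriv hm hg hdc w)
  have h1 := (hl 0 h00).tendsto.comp hy0
  have h2 := ((hρ 0 h00).tendsto.comp hy0).const_mul (lam ^ w.length)
  exact tendsto_nhds_unique (h1.congr hrel) h2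

/-- Dividing the relation for `i :: w` by the one for `w` gives the claim at `wordMap g w 0`; both
sides are continuous, so it passes to the closure. -/
theorem density_orbitClosure (hpos : ∀ i, ∀ x ∈ I, 0 < d i x)
    (hm : ∀ i, MapsTo (g i) I I) (hg : ∀ i, ContinuousOn (g i) I)
    (hdc : ∀ i, ContinuousOn (d i) I) (hρ : ContinuousOn ρ I)
    (hw : ∀ w, ρ (wordMap g w 0) * wordDeriv g d w 0 = lam ^ w.length * ρ 0) (i : Fin 2) :
    ∀ x ∈ orbitClosure g, ρ (g i x) * d i x = lam * ρ x := by
  have hsub := orbitClosure_subset hm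
  have hE : EqOn (fun x => ρ (g i x) * d i x) (fun x => lam * ρ x)
      (range fun w => wordMap g w 0) := by
    rintro _ ⟨w, rfl⟩
    have h1 := hw (i :: w)
    have h2 := hw w
    simp only [wordMap, wordDeriv, Function.comp_apply, List.length_cons, pow_succ] at h1
    have h3 : wordDeriv g d w 0 ≠ 0 := by
      have : ∀ v : List (Fin 2), 0 < wordDeriv g d v 0 := by
        intro v
        induction v with
        | nil => exact one_pos
        | cons j v ih => exact mul_pos (hpos j _ (wordMap_mapsTo hm v (by simp))) ih
      exact (this w).ne'
    apply mul_right_cancel₀ h3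
    simp only
    linear_combination h1 - lam * h2
  exact hE.of_subset_closure
    (((hρ.comp (hg i) (hm i)).mul (hdc i)).mono hsub) ((continuousOn_const.mul hρ).mono hsub)
    subset_closure le_rfl

end Livsic

/-! ### The transfer operator -/

section Transfer

variable {g d : Fin 2 → ℝ → ℝ} {ρ : ℝ → ℝ} {lam M α : ℝ}

/-- Iterates of the transfer operator `u ↦ ∑ i, (u ∘ g i) * d i` applied to `ρ`. -/
def transferIter (g d : Fin 2 → ℝ → ℝ) (ρ : ℝ → ℝ) : ℕ → ℝ → ℝ
  | 0 => ρ
  | j + 1 => fun x =>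
    transferIter g d ρ j (g 0 x) * d 0 x + transferIter g d ρ j (g 1 x) * d 1 x

theorem transferIter_pos (hpos : ∀ i, ∀ x ∈ I, 0 < d i x) (hm : ∀ i, MapsTo (g i) I I)
    (hρ : ∀ x ∈ I, 0 < ρ x) (j : ℕ) : ∀ x ∈ I, 0 < transferIter g d ρ j x := by
  induction j with
  | zero => exact hρ
  | succ j ih =>
    exact fun x hx => add_pos (mul_pos (ih _ (hm 0 hx)) (hpos 0 x hx))
      (mul_pos (ih _ (hm 1 hx)) (hpos 1 x hx))

theorem cls_transferIter {β : Option ℝ} (hβ : ValidExp β) {m : ℕ} (hm : ∀ i, MapsTo (g i) I I)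
    (hg : ∀ i, Cls β (m + 1) (g i)) (hd : ∀ i, Cls β m (d i)) (hρ : Cls β m ρ) (j : ℕ) :
    Cls β m (transferIter g d ρ j) := by
  induction j with
  | zero => exact hρ
  | succ j ih =>
    have key : ∀ i, Cls β m fun x => transferIter g d ρ j (g i x) * d i x := fun i =>
      (ih.comp hβ ((hg i).of_succ hβ) (hm i) ((hg i).lipschitz hβ).choose_spec).mul hβ (hd i)
    exact (key 0).add hβ (key 1)

theorem transferIter_orbit {X : Set ℝ} (hX : ∀ i, MapsTo (g i) X X)
    (h : ∀ i, ∀ x ∈ X, ρ (g i x) * d i x = lam * ρ x) (j : ℕ) :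
    ∀ x ∈ X, transferIter g d ρ j x = (2 * lam) ^ j * ρ x := by
  induction j with
  | zero => intro x _; simp [transferIter]
  | succ j ih =>
    intro x hx
    simp only [transferIter]
    rw [ih _ (hX 0 hx), ih _ (hX 1 hx), mul_assoc, mul_assoc, h 0 x hx, h 1 x hx]
    ring

/-- Bounded distortion. -/
theorem transferIter_distortion (hα0 : 0 < α) (hM0 : 0 ≤ M) (hM : M < 1)
    (hpos : ∀ i, ∀ x ∈ I, 0 < d i x) (hm : ∀ i, MapsTo (g i) I I)
    (hLip : ∀ i, ∀ x ∈ I, ∀ y ∈ I, |g i x - g i y| ≤ M * |x - y|)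
    (hρ : ∀ x ∈ I, 0 < ρ x) (hlogd : ∀ i, Base (some α) fun x => Real.log (d i x))
    (hlogρ : Base (some α) fun x => Real.log (ρ x)) :
    ∃ K : ℝ, 0 ≤ K ∧ ∀ j, ∀ x ∈ I, ∀ y ∈ I,
      transferIter g d ρ j x ≤ Real.exp K * transferIter g d ρ j y := by
  obtain ⟨A, hA0, hA⟩ := hlogρ.holder_nonneg
  obtain ⟨B, hB0, hB⟩ := (hlogd 0).holder_nonneg
  obtain ⟨C, hC0, hC⟩ := (hlogd 1).holder_nonneg
  have hMα : M ^ α < 1 := Real.rpow_lt_one hM0 hM hα0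
  have hMα0 : 0 ≤ M ^ α := Real.rpow_nonneg hM0 α
  -- Large enough for the initial density (`A ≤ K`) and stable under one step: `B + C + K * M ^ α ≤
  -- K`.
  set K := A + (B + C) / (1 - M ^ α) with hK
  have hK1 : 0 ≤ (B + C) / (1 - M ^ α) := div_nonneg (by positivity) (by linarith)
  have hK0 : 0 ≤ K := by positivity
  have hKe : B + C + K * M ^ α ≤ K := by
    have e : (B + C) / (1 - M ^ α) * (1 - M ^ α) = B + C := by
      field_simp [(by linarith : (1 - M ^ α) ≠ 0)]
    have : A * M ^ α ≤ A := mul_le_of_le_one_right hA0 hMα.le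
    rw [hK]
    nlinarith
  have hlog : ∀ {u v t : ℝ}, 0 < u → 0 < v → |Real.log u - Real.log v| ≤ t →
      u ≤ Real.exp t * v := by
    intro u v t hu hv h
    rw [← Real.exp_log hu]
    conv_rhs => rw [← Real.exp_log hv]
    rw [← Real.exp_add]
    apply Real.exp_le_exp.2
    linarith [le_abs_self (Real.log u - Real.log v)]
  have hdle : ∀ i, ∀ x ∈ I, ∀ y ∈ I, d i x ≤ Real.exp ((B + C) * |x - y| ^ α) * d i y := by
    intro i x hx y hy
    refine hlog (hpos i x hx) (hpos i y hy) ?_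
    have hp : 0 ≤ |x - y| ^ α := by positivity
    fin_cases i
    · exact (hB x hx y hy).trans (by nlinarith)
    · exact (hC x hx y hy).trans (by nlinarith)
  have key : ∀ j, ∀ x ∈ I, ∀ y ∈ I,
      transferIter g d ρ j x ≤ Real.exp (K * |x - y| ^ α) * transferIter g d ρ j y := by
    intro j
    induction j with
    | zero =>
      intro x hx y hy
      refine hlog (hρ x hx) (hρ y hy) ((hA x hx y hy).trans ?_)
      have hp : 0 ≤ |x - y| ^ α := by positivity
      gcongr
      linarith
    | succ j ih =>
      intro x hx y hy
      have hterm : ∀ i, transferIter g d ρ j (g i x) * d i x ≤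
          Real.exp (K * |x - y| ^ α) * (transferIter g d ρ j (g i y) * d i y) := by
        intro i
        have h1 : |g i x - g i y| ^ α ≤ M ^ α * |x - y| ^ α := by
          rw [← Real.mul_rpow hM0 (abs_nonneg _)]
          exact Real.rpow_le_rpow (abs_nonneg _) (hLip i x hx y hy) hα0.le
        have hp : 0 ≤ |x - y| ^ α := by positivity
        calc transferIter g d ρ j (g i x) * d i x
            ≤ (Real.exp (K * |g i x - g i y| ^ α) * transferIter g d ρ j (g i y)) *
              (Real.exp ((B + C) * |x - y| ^ α) * d i y) :=
              mul_le_mul (ih _ (hm i hx) _ (hm i hy)) (hdle i x hx y hy) (hpos i x hx).le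
                (mul_nonneg (Real.exp_nonneg _) (transferIter_pos hpos hm hρ j _ (hm i hy)).le)
          _ = Real.exp (K * |g i x - g i y| ^ α + (B + C) * |x - y| ^ α) *
              (transferIter g d ρ j (g i y) * d i y) := by rw [Real.exp_add]; ring
          _ ≤ _ := by
              refine mul_le_mul_of_nonneg_right (Real.exp_le_exp.2 ?_)
                (mul_nonneg (transferIter_pos hpos hm hρ j _ (hm i hy)).le (hpos i y hy).le)
              nlinarith
      simp only [transferIter]
      rw [mul_add]
      exact add_le_add (hterm 0) (hterm 1)
  refine ⟨K, hK0, fun j x hx y hy => (key j x hx y hy).trans ?_⟩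
  refine mul_le_mul_of_nonneg_right (Real.exp_le_exp.2 ?_) (transferIter_pos hpos hm hρ j y hy).le
  exact mul_le_of_le_one_right hK0
    (Real.rpow_le_one (abs_nonneg _) (abs_sub_le_one hx hy) hα0.le)

theorem le_sub_of_deriv_ge {f f' : ℝ → ℝ} {c : ℝ} (hf : ∀ x ∈ I, HasDerivWithinAt f (f' x) I x)
    (hc : ∀ x ∈ I, c ≤ f' x) : ∀ x ∈ I, ∀ y ∈ I, x ≤ y → c * (y - x) ≤ f y - f x := by
  have hd : ∀ x ∈ interior I, HasDerivAt f (f' x) x := fun x hx =>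
    (hf x (interior_subset hx)).hasDerivAt (mem_interior_iff_mem_nhds.1 hx)
  refine (convex_Icc 0 1).mul_sub_le_image_sub_of_le_deriv
    (fun x hx => (hf x hx).continuousWithinAt)
    (fun x hx => (hd x hx).differentiableAt.differentiableWithinAt) fun x hx => ?_
  rw [(hd x hx).deriv]
  exact hc x (interior_subset hx)

/-- The gaps of all generations have bounded total length, so the slope is less than `1/2`. -/
theorem slope_lt_half (hm : ∀ i, MapsTo (g i) I I)
    (hd : ∀ i, ∀ x ∈ I, HasDerivWithinAt (g i) (d i x) I x) (h0 : g 0 0 = 0) (h1 : g 1 1 = 1)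
    (hgap : g 0 1 < g 1 0) (hρc : ContinuousOn ρ I) (hρ : ∀ x ∈ I, 0 < ρ x)
    (hT : ∀ j, transferIter g d ρ j 0 = (2 * lam) ^ j * ρ 0) {K : ℝ}
    (hK : ∀ j, ∀ x ∈ I, ∀ y ∈ I,
      transferIter g d ρ j x ≤ Real.exp K * transferIter g d ρ j y) : lam < 1 / 2 := by
  by_contra hcon
  push Not at hcon
  have i0 : (0 : ℝ) ∈ I := by simp
  have i1 : (1 : ℝ) ∈ I := by simp
  obtain ⟨V, -, hV⟩ := exists_primitive hρc 0
  -- A primitive of the `j`-th transfer iterate: `S j 1 - S j 0` is the `ρ`-mass of the union of the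
  -- cylinders of generation `j`.
  let S : ℕ → ℝ → ℝ := fun j => Nat.rec V (fun _ u x => u (g 0 x) + u (g 1 x)) j
  have hS : ∀ j, ∀ x ∈ I, HasDerivWithinAt (S j) (transferIter g d ρ j x) I x := by
    intro j
    induction j with
    | zero => exact hV
    | succ j ih =>
      exact fun x hx => ((ih _ (hm 0 hx)).comp x (hd 0 x hx) (hm 0)).add
        ((ih _ (hm 1 hx)).comp x (hd 1 x hx) (hm 1))
  set c := Real.exp (-K) * ρ 0 with hc
  have hc0 : 0 < c := mul_pos (Real.exp_pos _) (hρ 0 i0)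
  have hTc : ∀ j, ∀ x ∈ I, c ≤ transferIter g d ρ j x := by
    intro j x hx
    have h2 := hK j 0 i0 x hx
    rw [hT j] at h2
    have h3 : ρ 0 ≤ (2 * lam) ^ j * ρ 0 :=
      le_mul_of_one_le_left (hρ 0 i0).le (one_le_pow₀ (by linarith))
    calc c ≤ Real.exp (-K) * (Real.exp K * transferIter g d ρ j x) := by
          rw [hc]; gcongr; linarith
      _ = transferIter g d ρ j x := by
          rw [← mul_assoc, ← Real.exp_add, neg_add_cancel, Real.exp_zero, one_mul]
  -- Passing to the next generation removes the increment of `S j` over the central gap, which is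
  -- bounded below when `1 ≤ 2 * lam`.
  have hrec : ∀ j, S (j + 1) 1 - S (j + 1) 0 ≤ S j 1 - S j 0 - c * (g 1 0 - g 0 1) := by
    intro j
    have h2 := le_sub_of_deriv_ge (hS j) (hTc j) _ (hm 0 i1) _ (hm 1 i0) hgap.le
    have e : S (j + 1) 1 - S (j + 1) 0 =
        (S j (g 0 1) + S j (g 1 1)) - (S j (g 0 0) + S j (g 1 0)) := rfl
    rw [e, h0, h1]
    linarith
  have hbound : ∀ j : ℕ, S j 1 - S j 0 ≤ S 0 1 - S 0 0 - j * (c * (g 1 0 - g 0 1)) := by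
    intro j
    induction j with
    | zero => simp
    | succ j ih =>
      have := hrec j
      push_cast
      linarith
  have hnn : ∀ j, 0 ≤ S j 1 - S j 0 := by
    intro j
    have := le_sub_of_deriv_ge (hS j) (hTc j) 0 i0 1 i1 zero_le_one
    linarith
  obtain ⟨n, hn⟩ := exists_nat_gt ((S 0 1 - S 0 0) / (c * (g 1 0 - g 0 1)))
  rw [div_lt_iff₀ (mul_pos hc0 (by linarith))] at hn
  linarith [hbound n, hnn n]

/-- A density adapted to the system: the conjugate maps contract, and have slope `lam` on the
invariant set `X`. -/
theorem exists_adapted_density (hlam : 0 < lam) (hlam2 : lam < 1 / 2) {X : Set ℝ}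
    (hm : ∀ i, MapsTo (g i) I I) (hpos : ∀ i, ∀ x ∈ I, 0 < d i x) (hρ : ∀ x ∈ I, 0 < ρ x)
    (hX : ∀ i, MapsTo (g i) X X) (hXρ : ∀ i, ∀ x ∈ X, ρ (g i x) * d i x = lam * ρ x)
    (hX0 : (0 : ℝ) ∈ X) {K : ℝ} (hK : ∀ j, ∀ x ∈ I, ∀ y ∈ I,
      transferIter g d ρ j x ≤ Real.exp K * transferIter g d ρ j y) :
    ∃ (N : ℕ) (θ : ℝ) (R : ℝ → ℝ), θ < 1 ∧
      (R = fun x => ∑ j ∈ Finset.range N, (θ⁻¹) ^ j * transferIter g d ρ j x) ∧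
      (∀ x ∈ I, 0 < R x) ∧ (∀ i, ∀ x ∈ I, R (g i x) * d i x ≤ θ * R x) ∧
      ∀ i, ∀ x ∈ X, R (g i x) * d i x = lam * R x := by
  -- Any number strictly between `2 * lam` and `1` would do.
  set θ : ℝ := (2 * lam + 1) / 2 with hθ
  have hθ0 : 0 < θ := by rw [hθ]; linarith
  have hθ1 : θ < 1 := by rw [hθ]; linarith
  have hr : 2 * lam / θ < 1 := by rw [div_lt_one hθ0, hθ]; linarith
  have ht : Tendsto (fun n : ℕ => Real.exp (K + K) * (2 * lam / θ) ^ n) atTop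
      (𝓝 (Real.exp (K + K) * 0)) :=
    (tendsto_pow_atTop_nhds_zero_of_lt_one (by positivity) hr).const_mul _
  rw [mul_zero] at ht
  obtain ⟨N, hN, hN1⟩ := ((ht.eventually (gt_mem_nhds one_pos)).and (eventually_ge_atTop 1)).exists
  have i0 : (0 : ℝ) ∈ I := by simp
  have hTpos := transferIter_pos hpos hm hρ
  -- Distortion is used twice, from `x` to `0`, where the iterate is known exactly, and from `0`
  -- back to `x`; `N` was chosen to absorb `exp (K + K)`.
  have hTN : ∀ x ∈ I, (θ⁻¹) ^ N * transferIter g d ρ N x ≤ ρ x := by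
    intro x hx
    have h1 := hK N x hx 0 i0
    rw [transferIter_orbit hX hXρ N 0 hX0] at h1
    have h2 : ρ 0 ≤ Real.exp K * ρ x := hK 0 0 i0 x hx
    calc (θ⁻¹) ^ N * transferIter g d ρ N x
        ≤ (θ⁻¹) ^ N * (Real.exp K * ((2 * lam) ^ N * (Real.exp K * ρ x))) := by
          refine mul_le_mul_of_nonneg_left (h1.trans ?_) (by positivity)
          gcongr
      _ = (Real.exp (K + K) * (2 * lam / θ) ^ N) * ρ x := by
          rw [Real.exp_add, div_eq_mul_inv, mul_pow (2 * lam)]; ring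
      _ ≤ 1 * ρ x := mul_le_mul_of_nonneg_right hN.le (hρ x hx).le
      _ = ρ x := one_mul _
  refine ⟨N, θ, _, hθ1, rfl, ?_, ?_, ?_⟩
  · intro x hx
    exact Finset.sum_pos (fun j _ => mul_pos (by positivity) (hTpos j x hx)) ⟨0, by simp; omega⟩
  · intro i x hx
    have hstep : ∀ j, transferIter g d ρ j (g i x) * d i x ≤ transferIter g d ρ (j + 1) x := by
      intro j
      simp only [transferIter]
      have a0 := mul_pos (hTpos j _ (hm 0 hx)) (hpos 0 x hx)
      have a1 := mul_pos (hTpos j _ (hm 1 hx)) (hpos 1 x hx)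
      fin_cases i
      · exact le_add_of_nonneg_right a1.le
      · exact le_add_of_nonneg_left a0.le
    calc (∑ j ∈ Finset.range N, (θ⁻¹) ^ j * transferIter g d ρ j (g i x)) * d i x
        ≤ ∑ j ∈ Finset.range N, θ * ((θ⁻¹) ^ (j + 1) * transferIter g d ρ (j + 1) x) := by
          rw [Finset.sum_mul]
          refine Finset.sum_le_sum fun j _ => ?_
          have e : θ * ((θ⁻¹) ^ (j + 1) * transferIter g d ρ (j + 1) x) =
              (θ⁻¹) ^ j * transferIter g d ρ (j + 1) x := by
            rw [pow_succ]; field_simp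
          rw [e, mul_assoc]
          exact mul_le_mul_of_nonneg_left (hstep j) (by positivity)
      _ = θ * (∑ j ∈ Finset.range N, (θ⁻¹) ^ (j + 1) * transferIter g d ρ (j + 1) x) := by
          rw [Finset.mul_sum]
      _ ≤ θ * ∑ j ∈ Finset.range N, (θ⁻¹) ^ j * transferIter g d ρ j x := by
          refine mul_le_mul_of_nonneg_left ?_ hθ0.le
          -- The shifted sum differs from the original by its new last term minus its old first term
          -- `ρ x`, which is nonpositive by `hTN`.
          have h1 := Finset.sum_range_succ (fun j => (θ⁻¹) ^ j * transferIter g d ρ j x) N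
          have h2 := Finset.sum_range_succ' (fun j => (θ⁻¹) ^ j * transferIter g d ρ j x) N
          have h3 := hTN x hx
          simp only [pow_zero, one_mul, transferIter] at h1 h2 h3 ⊢
          linarith
  · intro i x hx
    rw [Finset.sum_mul, Finset.mul_sum]
    refine Finset.sum_congr rfl fun j _ => ?_
    rw [transferIter_orbit hX hXρ j _ (hX i hx), transferIter_orbit hX hXρ j x hx]
    linear_combination (θ⁻¹ ^ j * (2 * lam) ^ j) * hXρ i x hx

end Transfer

/-! ### Conjugation to a pseudo-affine system -/

theorem Cls.sum {β : Option ℝ} (hβ : ValidExp β) {m : ℕ} {f : ℕ → ℝ → ℝ}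
    (hf : ∀ j, Cls β m (f j)) (N : ℕ) : Cls β m fun x => ∑ j ∈ Finset.range N, f j x := by
  induction N with
  | zero => exact (Cls.const hβ 0 m).congr fun x _ => by simp
  | succ N ih => exact (ih.add hβ (hf N)).congr fun x _ => Finset.sum_range_succ _ _

/-- A system conjugated by the normalized primitive of a density `R`. -/
theorem exists_conjugate_of_density {s : Regularity} (hs : s.Admissible) {g d : Fin 2 → ℝ → ℝ}
    {R : ℝ → ℝ} {lam θ : ℝ} {X : Set ℝ} (hm : ∀ i, MapsTo (g i) I I)
    (hg : ∀ p ∈ s.indices, ∀ i, Cls p.1 (p.2 + 1) (g i))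
    (hd : ∀ i, ∀ x ∈ I, HasDerivWithinAt (g i) (d i x) I x) (hpos : ∀ i, ∀ x ∈ I, 0 < d i x)
    (h0 : g 0 0 = 0) (h1 : g 1 1 = 1) (hl : g 0 0 < g 0 1) (hgap : g 0 1 < g 1 0)
    (hr : g 1 0 < g 1 1) (hX : IsAttractor g X)
    (hR : ∀ p ∈ s.indices, Cls p.1 p.2 R) (hRpos : ∀ x ∈ I, 0 < R x) (hθ : θ < 1)
    (hRθ : ∀ i, ∀ x ∈ I, R (g i x) * d i x ≤ θ * R x)
    (hRX : ∀ i, ∀ x ∈ X, R (g i x) * d i x = lam * R x) :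
    ∃ f : Fin 2 → ℝ → ℝ, IsHyperbolic s f ∧ IsPseudoAffine f lam ∧ IsConjugate s g f := by
  have i0 : (0 : ℝ) ∈ I := by simp
  have i1 : (1 : ℝ) ∈ I := by simp
  obtain ⟨p₀, hp₀⟩ := s.indices_nonempty
  have hβ := hs.validExp
  have hRc : ContinuousOn R I := (hR p₀ hp₀).continuousOn (hβ p₀ hp₀)
  obtain ⟨V, hV0, hV⟩ := exists_primitive hRc 0
  obtain ⟨c, hc0, hc⟩ := exists_pos_lower_bound hRc hRpos
  have hV1 : 0 < V 1 := by
    have := le_sub_of_deriv_ge hV hc 0 i0 1 i1 zero_le_one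
    rw [hV0] at this
    linarith
  set H : ℝ → ℝ := fun x => V x * (V 1)⁻¹ with hH
  set Q : ℝ → ℝ := fun x => R x * (V 1)⁻¹ with hQ
  have hHd : ∀ x ∈ I, HasDerivWithinAt H (Q x) I x := fun x hx => (hV x hx).mul_const _
  have hQpos : ∀ x ∈ I, 0 < Q x := fun x hx => mul_pos (hRpos x hx) (inv_pos.2 hV1)
  have hQcls : ∀ p ∈ s.indices, Cls p.1 p.2 Q := fun p hp =>
    (hR p hp).mul (hβ p hp) (Cls.const (hβ p hp) _ _)
  have hHcls : ∀ p ∈ s.indices, Cls p.1 (p.2 + 1) H := fun p hp => ⟨Q, hHd, hQcls p hp⟩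
  have hQθ : ∀ i, ∀ x ∈ I, Q (g i x) * d i x ≤ θ * Q x := by
    intro i x hx
    have := mul_le_mul_of_nonneg_right (hRθ i x hx) (inv_pos.2 hV1).le
    simp only [hQ]
    linarith
  have hQX : ∀ i, ∀ x ∈ X, Q (g i x) * d i x = lam * Q x := by
    intro i x hx
    simp only [hQ]
    linear_combination (V 1)⁻¹ * hRX i x hx
  have hH0 : H 0 = 0 := by simp [hH, hV0]
  have hH1 : H 1 = 1 := mul_inv_cancel₀ hV1.ne'
  have hHc : ContinuousOn H I := fun x hx => (hHd x hx).continuousWithinAt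
  obtain ⟨b, hb0, hb⟩ := exists_pos_lower_bound ((hQcls p₀ hp₀).continuousOn (hβ p₀ hp₀)) hQpos
  have hHlow := le_sub_of_deriv_ge hHd hb
  have hHlt : ∀ x ∈ I, ∀ y ∈ I, x < y → H x < H y := by
    intro x hx y hy hxy
    have := hHlow x hx y hy hxy.le
    nlinarith [mul_pos hb0 (sub_pos.2 hxy)]
  obtain ⟨k, hHm, hkm, hkH, hHk, hkL⟩ := exists_inverse hHc hH0 hH1 hb0 hHlow
  have hk0 : k 0 = 0 := by have := hkH 0 i0; rwa [hH0] at this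
  have hk1 : k 1 = 1 := by have := hkH 1 i1; rwa [hH1] at this
  have hkcls : ∀ p ∈ s.indices, Cls p.1 (p.2 + 1) k := fun p hp =>
    cls_inverse (hβ p hp) hkm hHk hkL hHd hQpos (hQcls p hp)
  have hkd : ∀ x ∈ I, HasDerivWithinAt k (Q (k x))⁻¹ I x := fun x hx =>
    hasDerivWithinAt_inverse hx hkm hHk (continuousOn_of_lipschitz hkL) (hHd _ (hkm hx))
      (hQpos _ (hkm hx)).ne'
  let f : Fin 2 → ℝ → ℝ := fun i x => H (g i (k x))
  -- The derivative of the conjugate map; the normalization of the density cancels in it.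
  let D : Fin 2 → ℝ → ℝ := fun i x => Q (g i (k x)) * (d i (k x) * (Q (k x))⁻¹)
  have hfm : ∀ i, MapsTo (f i) I I := fun i x hx => hHm (hm i (hkm hx))
  have hfd : ∀ i, ∀ x ∈ I, HasDerivWithinAt (f i) (D i x) I x := fun i x hx =>
    HasDerivWithinAt.comp (h₂ := H) (h₂' := Q (g i (k x))) x (hHd _ (hm i (hkm hx)))
      ((hd i _ (hkm hx)).comp x (hkd x hx) hkm) ((hm i).comp hkm)
  have hDpos : ∀ i, ∀ x ∈ I, 0 < D i x := fun i x hx =>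
    mul_pos (hQpos _ (hm i (hkm hx))) (mul_pos (hpos i _ (hkm hx)) (inv_pos.2 (hQpos _ (hkm hx))))
  have hDθ : ∀ i, ∀ x ∈ I, D i x ≤ θ := by
    intro i x hx
    have := hQθ i _ (hkm hx)
    have hq := hQpos _ (hkm hx)
    calc D i x = (Q (g i (k x)) * d i (k x)) / Q (k x) := by simp only [D]; ring
      _ ≤ θ := by rwa [div_le_iff₀ hq]
  have hfcls : ∀ p ∈ s.indices, ∀ i, Cls p.1 (p.2 + 1) (f i) := fun p hp i =>
    have hv := hβ p hp
    (hHcls p hp).comp hv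
      ((hg p hp i).comp hv (hkcls p hp) hkm hkL) ((hm i).comp hkm)
      (Cls.lipschitz hv ((hg p hp i).comp hv (hkcls p hp) hkm hkL)).choose_spec
  have hDc : ∀ i, ContinuousOn (D i) I := fun i =>
    ((hfcls p₀ hp₀ i).of_deriv (hfd i)).continuousOn (hβ p₀ hp₀)
  have hDw : ∀ i, ∀ x ∈ I, derivWithin (f i) I x = D i x := fun i x hx =>
    HasDerivWithinAt.derivWithin_I hx (hfd i x hx)
  refine ⟨f, ⟨⟨hfm, fun i => hs.isOfClass_iff.2 fun p hp => hfcls p hp i, ?_, ?_⟩, ?_, ?_, ?_, ?_,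
    ?_, ?_⟩, ?_, ?_⟩
  · intro i x hx
    rw [hDw i x hx]
    exact (hDpos i x hx).ne'
  · refine ⟨θ, hθ, fun i => lipschitz_of_deriv_le (hfd i) fun x hx => ?_⟩
    rw [abs_of_pos (hDpos i x hx)]
    exact hDθ i x hx
  · obtain ⟨m₀, hm₀, hmle₀⟩ := exists_pos_lower_bound (hDc 0) (hDpos 0)
    obtain ⟨m₁, hm₁, hmle₁⟩ := exists_pos_lower_bound (hDc 1) (hDpos 1)
    refine ⟨min m₀ m₁, θ, lt_min hm₀ hm₁, hθ, fun i x hx => ?_⟩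
    rw [hDw i x hx, abs_of_pos (hDpos i x hx)]
    refine ⟨?_, hDθ i x hx⟩
    fin_cases i
    · exact (min_le_left _ _).trans (hmle₀ x hx)
    · exact (min_le_right _ _).trans (hmle₁ x hx)
  · simp only [f]; rw [hk0, h0, hH0]
  · simp only [f]; rw [hk0, hk1]; exact hHlt _ (hm 0 i0) _ (hm 0 i1) hl
  · simp only [f]; rw [hk0, hk1]; exact hHlt _ (hm 0 i1) _ (hm 1 i0) hgap
  · simp only [f]; rw [hk0, hk1]; exact hHlt _ (hm 1 i0) _ (hm 1 i1) hr
  · simp only [f]; rw [hk1, h1, hH1]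
  · refine ⟨H '' X, ⟨?_, hX.nonempty.image H, hX.isCompact.image_of_continuousOn
      (hHc.mono hX.subset), ?_⟩, ?_⟩
    · rintro _ ⟨x, hx, rfl⟩
      exact hHm (hX.subset hx)
    · have e : ∀ i, f i '' (H '' X) = H '' (g i '' X) := by
        intro i
        rw [image_image, image_image]
        exact image_congr fun x hx => by simp only [f]; rw [hkH x (hX.subset hx)]
      simp only [e]
      rw [← image_iUnion, ← hX.eq_iUnion]
    · rintro i _ ⟨x, hx, rfl⟩
      have hxI := hX.subset hx
      rw [hDw i _ (hHm hxI)]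
      simp only [D]
      rw [hkH x hxI, ← mul_assoc, hQX i x hx, mul_assoc, mul_inv_cancel₀ (hQpos x hxI).ne', mul_one]
  · exact ⟨H, k, ⟨hHm, hkm, hkH, hHk, hs.isOfClass_iff.2 hHcls, hs.isOfClass_iff.2 hkcls⟩,
      Equiv.refl _, fun i x _ => rfl⟩

theorem pos_of_ne_zero {f : ℝ → ℝ} (hf : ContinuousOn f I) (hne : ∀ x ∈ I, f x ≠ 0) {y : ℝ}
    (hy : y ∈ I) (hpos : 0 < f y) : ∀ x ∈ I, 0 < f x := by
  intro x hx
  by_contra hcon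
  push Not at hcon
  obtain ⟨z, hz, hz0⟩ := isPreconnected_Icc.intermediate_value hx hy hf ⟨hcon, hpos.le⟩
  exact hne z hz hz0

/-- Above `C^1`, the Livsic condition implies conjugacy to a pseudo-affine system. -/
theorem exists_pseudoAffine_conjugate {s : Regularity} (hs : s.Admissible) (hs1 : 1 < s.value)
    {g : Fin 2 → ℝ → ℝ} {lam : ℝ} (hg : IsHyperbolic s g) (hlam : 0 < lam)
    (hL : LivsicCondition g lam) :
    lam < 1 / 2 ∧ ∃ f : Fin 2 → ℝ → ℝ,
      IsHyperbolic s f ∧ IsPseudoAffine f lam ∧ IsConjugate s g f := by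
  have i0 : (0 : ℝ) ∈ I := by simp
  have i1 : (1 : ℝ) ∈ I := by simp
  obtain ⟨α, hα0, hα1, hα⟩ := hs.exists_holder hs1
  have hvα : ValidExp (some α) := ⟨hα0, hα1⟩
  have hm := hg.isSelfConformal.mapsTo
  have hgcls : ∀ p ∈ s.indices, ∀ i, Cls p.1 (p.2 + 1) (g i) := fun p hp i =>
    hs.isOfClass_iff.1 (hg.isSelfConformal.isOfClass i) p hp
  have hgα : ∀ i, Cls (some α) 1 (g i) := fun i => hα _ (hg.isSelfConformal.isOfClass i)
  set d : Fin 2 → ℝ → ℝ := fun i => derivWithin (g i) I with hddef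
  have hd : ∀ i, ∀ x ∈ I, HasDerivWithinAt (g i) (d i x) I x := by
    intro i x hx
    obtain ⟨e, he, -⟩ := hgα i
    exact (he x hx).differentiableWithinAt.hasDerivWithinAt
  have hdα : ∀ i, Base (some α) (d i) := fun i => (hgα i).of_deriv (hd i)
  have hdcls : ∀ p ∈ s.indices, ∀ i, Cls p.1 p.2 (d i) := fun p hp i =>
    (hgcls p hp i).of_deriv (hd i)
  have hdc : ∀ i, ContinuousOn (d i) I := fun i => (hdα i).continuousOn hvα
  have hgc : ∀ i, ContinuousOn (g i) I := fun i x hx => (hd i x hx).continuousWithinAt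
  have hfix : ∀ i, ∀ x ∈ I, g i x = x → d i x = lam := by
    intro i x hx h
    have := hL [i] x hx h
    simpa [wordMap] using this
  have hd0 : d 0 0 = lam := hfix 0 0 i0 hg.zero_fixed
  -- The Livsic condition fixes the sign at the fixed points `0` and `1`; continuity and
  -- nonvanishing propagate it.
  have hpos : ∀ i, ∀ x ∈ I, 0 < d i x := by
    intro i
    have hne := hg.isSelfConformal.nonsingular i
    fin_cases i
    · exact pos_of_ne_zero (hdc 0) hne i0 (hd0.symm ▸ hlam)
    · exact pos_of_ne_zero (hdc 1) hne i1 ((hfix 1 1 i1 hg.one_fixed).symm ▸ hlam)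
  obtain ⟨m₀, M, hm₀, hM, hdM⟩ := hg.deriv_bounds
  have hM0 : 0 < M := hm₀.trans_le ((hdM 0 0 i0).1.trans (hdM 0 0 i0).2)
  have hLip : ∀ i, ∀ x ∈ I, ∀ y ∈ I, |g i x - g i y| ≤ M * |x - y| := fun i =>
    lipschitz_of_deriv_le (hd i) fun x hx => (hdM i x hx).2
  set φ : ℝ → ℝ := fun x => Real.log (d 0 x) + -Real.log lam with hφ
  have hφcls : ∀ {β : Option ℝ} {m : ℕ}, ValidExp β → Cls β m (d 0) → Cls β m φ :=
    fun hβ h => (h.log hβ (hpos 0)).add hβ (Cls.const hβ _ _)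
  obtain ⟨ψ, hψc, hψ⟩ := exists_coboundary (g := g 0) hα0 hα1 hM0.le hM (hm 0) (hLip 0)
    hg.zero_fixed (hφcls (m := 0) hvα (hdα 0)) (by simp [hφ, hd0])
  -- One and the same `ψ` lies in every class allowed by the data, which also covers `C^∞`.
  have hψcls : ∀ {β : Option ℝ} {m : ℕ}, ValidExp β → Cls β (m + 1) (g 0) → Cls β m (d 0) →
      Cls β m ψ := fun hβ h h' =>
    cls_coboundary hβ hM0 hM (hm 0) (hLip 0) hg.zero_fixed h hψc hψ (hφcls hβ h')
  set ρ : ℝ → ℝ := fun x => Real.exp (ψ x) with hρdef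
  have hρpos : ∀ x ∈ I, 0 < ρ x := fun x _ => Real.exp_pos _
  have hρc : ContinuousOn ρ I := hψc.rexp
  have hρ0 : ∀ x ∈ I, ρ (g 0 x) * d 0 x = lam * ρ x := by
    intro x hx
    simp only [hρdef, hψ x hx, hφ]
    rw [Real.exp_add, Real.exp_add, Real.exp_neg, Real.exp_log (hpos 0 x hx), Real.exp_log hlam]
    field_simp
  have hX := isAttractor_orbitClosure hm hgc hg.zero_fixed
  have hXm := maps_orbitClosure hm hgc hg.zero_fixed
  have hXρ := density_orbitClosure hpos hm hgc hdc hρc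
    (density_wordMap_zero hlam hL hm hd hdc hM0.le hM (hLip 0) hg.zero_fixed hρc hρ0)
  obtain ⟨K, -, hK⟩ := transferIter_distortion (ρ := ρ) hα0 hM0.le hM hpos hm hLip hρpos
    (fun i => (hdα i).log hvα (hpos i))
    ((hψcls (m := 0) hvα (hgα 0) (hdα 0)).congr fun x _ => by simp [hρdef])
  have hlt : lam < 1 / 2 := slope_lt_half hm hd hg.zero_fixed hg.one_fixed hg.lt_gap hρc hρpos
    (fun j => transferIter_orbit hXm hXρ j 0 (zero_mem_orbitClosure g)) hK
  obtain ⟨N, θ, R, hθ, hRdef, hRpos, hRθ, hRX⟩ := exists_adapted_density hlam hlt hm hpos hρpos hXm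
    hXρ (zero_mem_orbitClosure g) hK
  refine ⟨hlt, exists_conjugate_of_density hs hm hgcls hd hpos hg.zero_fixed hg.one_fixed hg.lt_left
    hg.lt_gap hg.lt_right hX (fun p hp => ?_) hRpos hθ hRθ hRX⟩
  have hv := hs.validExp p hp
  rw [hRdef]
  refine Cls.sum hv (f := fun j x => (θ⁻¹) ^ j * transferIter g d ρ j x) (fun j => ?_) N
  exact (Cls.const hv _ _).mul hv (cls_transferIter hv hm (hgcls p hp) (hdcls p hp)
    ((hψcls hv (hgcls p hp 0) (hdcls p hp 0)).exp hv) j)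

/-! ### A system of class `C^1` with unbounded distortion -/

/-- Differentiating the conjugacy on the attractor gives `h' (G_w 0) * G_w' 0 = lam ^ |w| * h' 0`.
As `h'` is bounded away from `0`, the ratios `G_w' 0 / lam ^ |w|` would be bounded. -/
theorem not_conjugate_of_unbounded {g d : Fin 2 → ℝ → ℝ} {lam : ℝ} (hlam : 0 < lam)
    (hm : ∀ i, MapsTo (g i) I I) (hd : ∀ i, ∀ x ∈ I, HasDerivWithinAt (g i) (d i x) I x)
    {M : ℝ} (hM0 : 0 ≤ M) (hM : M < 1) (hLip : ∀ x ∈ I, ∀ y ∈ I, |g 0 x - g 0 y| ≤ M * |x - y|)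
    (h0 : g 0 0 = 0) (hd0 : d 0 0 = lam)
    (hunb : ∀ C : ℝ, ∃ w : List (Fin 2), C * lam ^ w.length < wordDeriv g d w 0)
    {f : Fin 2 → ℝ → ℝ} {mu : ℝ} (hf : IsSelfConformal (.cont 1) f) (hmu : IsPseudoAffine f mu) :
    ¬ IsConjugate (.cont 1) g f := by
  rintro ⟨h, k, hh, τ, hconj⟩
  have hs : (Regularity.cont 1).Admissible := le_refl 1
  have i0 : (0 : ℝ) ∈ I := by simp
  obtain ⟨X, hX, hXmu⟩ := hmu
  have hcls : ∀ {u : ℝ → ℝ}, IsOfClass (.cont 1) u → Cls none 1 u := fun hu =>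
    hs.isOfClass_iff.1 hu _ rfl
  obtain ⟨h', hh', hh'c⟩ := hcls hh.isOfClass
  obtain ⟨k', hk', -⟩ := hcls hh.isOfClass_inv
  have hhc : ContinuousOn h I := fun x hx => (hh' x hx).continuousWithinAt
  have hh'0 : ∀ x ∈ I, h' x ≠ 0 := by
    intro x hx hzero
    have h1 := (hk' _ (hh.mapsTo hx)).comp x (hh' x hx) hh.mapsTo
    have h2 : HasDerivWithinAt (k ∘ h) 1 I x :=
      (hasDerivWithinAt_id x I).congr hh.left_inv (hh.left_inv x hx)
    have := hasDerivWithinAt_unique hx h1 h2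
    rw [hzero, mul_zero] at this
    exact zero_ne_one this
  have hconj' : ∀ i, ∀ x ∈ I, f (τ i) (h x) = h (g i x) := by
    intro i x hx
    rw [hconj i _ (hh.mapsTo hx), hh.left_inv x hx]
  have hinv : ∀ i, ∀ y ∈ I, h y ∈ X → h (g i y) ∈ X := by
    intro i y hy hyX
    rw [← hconj' i y hy, hX.eq_iUnion]
    exact mem_iUnion.2 ⟨τ i, h y, hyX, rfl⟩
  -- The preimage of `X` under `h` is invariant under `g 0`, whose orbits tend to `0`, and `X` is
  -- closed.
  have hzero : h 0 ∈ X := by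
    obtain ⟨x, hx⟩ := hX.nonempty
    have hkx := hh.mapsTo_inv (hX.subset hx)
    have hit : ∀ n, h ((g 0)^[n] (k x)) ∈ X := by
      intro n
      induction n with
      | zero => simpa [hh.right_inv x (hX.subset hx)] using hx
      | succ n ih =>
        rw [Function.iterate_succ_apply']
        exact hinv 0 _ ((hm 0).iterate n hkx) ih
    exact hX.isCompact.isClosed.mem_of_tendsto
      ((hhc 0 i0).tendsto.comp (tendsto_iterate_zero hM0 hM (hm 0) hLip h0 hkx))
      (Eventually.of_forall hit)
  have hrel : ∀ i, ∀ y ∈ I, h y ∈ X → h' (g i y) * d i y = mu * h' y := by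
    intro i y hy hyX
    obtain ⟨f', hf', -⟩ := hcls (hf.isOfClass (τ i))
    have h1 := (hh' _ (hm i hy)).comp y (hd i y hy) (hm i)
    have h2 := (hf' _ (hh.mapsTo hy)).comp y (hh' y hy) hh.mapsTo
    have h3 : f' (h y) = mu := by
      rw [← hXmu (τ i) _ hyX]
      exact (HasDerivWithinAt.derivWithin_I (hh.mapsTo hy) (hf' _ (hh.mapsTo hy))).symm
    rw [h3] at h2
    exact hasDerivWithinAt_unique hy h1 (h2.congr (fun x hx => (hconj' i x hx).symm)
      (hconj' i y hy).symm)
  -- The multiplier at the fixed point `0` is a conjugacy invariant.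
  have hmul : mu = lam := by
    have := hrel 0 0 i0 hzero
    rw [h0, hd0, mul_comm] at this
    exact (mul_right_cancel₀ (hh'0 0 i0) this).symm
  have hword : ∀ w : List (Fin 2), h (wordMap g w 0) ∈ X ∧
      h' (wordMap g w 0) * wordDeriv g d w 0 = lam ^ w.length * h' 0 := by
    intro w
    induction w with
    | nil => exact ⟨hzero, by simp [wordMap, wordDeriv]⟩
    | cons i w ih =>
      have hI := wordMap_mapsTo hm w i0
      refine ⟨hinv i _ hI ih.1, ?_⟩
      simp only [wordMap, wordDeriv, Function.comp_apply, List.length_cons]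
      rw [← mul_assoc, hrel i _ hI ih.1, hmul, mul_assoc, ih.2]
      ring
  obtain ⟨c, hc0, hc⟩ := exists_pos_lower_bound (f := fun x => |h' x|)
    (ContinuousOn.abs hh'c) fun x hx => abs_pos.2 (hh'0 x hx)
  obtain ⟨w, hw⟩ := hunb (|h' 0| / c)
  have h1 := congrArg abs (hword w).2
  rw [abs_mul, abs_mul, abs_of_pos (pow_pos hlam w.length)] at h1
  have h2 := hc _ (wordMap_mapsTo hm w i0)
  have h3 : c * wordDeriv g d w 0 ≤ lam ^ w.length * |h' 0| := by
    rw [← h1]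
    exact mul_le_mul h2 (le_abs_self _) (by
      refine le_trans ?_ hw.le
      positivity) (abs_nonneg _)
  have h4 : c * (|h' 0| / c * lam ^ w.length) = lam ^ w.length * |h' 0| := by
    field_simp
  nlinarith [mul_lt_mul_of_pos_left hw hc0]

/-! ### The affine model and its weighted Birkhoff sums -/

/-- The two affine branches, of ranges `[0,1/4]` and `[3/4,1]`. -/
noncomputable def branch (i : Fin 2) (x : ℝ) : ℝ := (x + ![0, 3] i) / 4

/-- A continuous left inverse of both branches which vanishes on `[1/2,3/4]`. -/
noncomputable def fold (x : ℝ) : ℝ := max 0 (min (4 * x) (2 - 4 * x)) + max 0 (4 * x - 3)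

/-- Divergent weights with summable differences. -/
noncomputable def weight (j : ℕ) : ℝ := 1 / 10 / ((j : ℝ) + 1)

/-- Weighted Birkhoff sums of the identity along `fold`. -/
noncomputable def birkhoff (s N : ℕ) (x : ℝ) : ℝ :=
  ∑ j ∈ Finset.range N, weight (s + j) * fold^[j] x

theorem branch_mapsTo (i : Fin 2) : MapsTo (branch i) I I := by
  rintro x ⟨h0, h1⟩
  fin_cases i <;> simp only [branch] <;> constructor <;> norm_num <;> linarith

theorem continuous_fold : Continuous fold := by unfold fold; fun_prop

theorem fold_mapsTo : MapsTo fold I I := by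
  rintro x ⟨h0, h1⟩
  unfold fold
  constructor
  · positivity
  · rcases le_total (4 * x - 3) 0 with h | h
    · rw [max_eq_left h, add_zero]
      refine max_le zero_le_one ?_
      rcases le_total (4 * x) 1 with h' | h'
      · exact (min_le_left _ _).trans h'
      · exact (min_le_right _ _).trans (by linarith)
    · rw [max_eq_right h, max_eq_left ((min_le_right _ _).trans (by linarith))]
      linarith

theorem fold_branch (i : Fin 2) {x : ℝ} (hx : x ∈ I) : fold (branch i x) = x := by
  obtain ⟨h0, h1⟩ := hx
  fin_cases i
  · simp only [branch, fold]
    norm_num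
    rw [min_eq_left (by linarith), max_eq_right (by linarith), max_eq_left (by linarith)]
    ring
  · simp only [branch, fold]
    norm_num
    rw [min_eq_right (by linarith), max_eq_left (by linarith), max_eq_right (by linarith)]
    ring

theorem weight_pos (j : ℕ) : 0 < weight j := by unfold weight; positivity

/-- The size `1/10` keeps `exp (2 * weight j)` below `5/4` for the integral bound, and the defect
small enough for the conjugate maps to contract. -/
theorem weight_le (j : ℕ) : weight j ≤ 1 / 10 := by
  unfold weight
  rw [div_le_iff₀ (by positivity)]
  have : (0 : ℝ) ≤ j := Nat.cast_nonneg j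
  linarith

theorem weight_antitone : Antitone weight := by
  intro i j h
  unfold weight
  have : (i : ℝ) ≤ j := Nat.cast_le.2 h
  gcongr

theorem tendsto_weight : Tendsto weight atTop (𝓝 0) := by
  have := (tendsto_one_div_add_atTop_nhds_zero_nat (𝕜 := ℝ)).const_mul (1 / 10)
  rw [mul_zero] at this
  refine this.congr fun j => ?_
  unfold weight
  ring

theorem tendsto_sum_weight : Tendsto (fun n => ∑ j ∈ Finset.range n, weight j) atTop atTop := by
  have := Real.tendsto_sum_range_one_div_nat_succ_atTop.const_mul_atTop
    (by norm_num : (0 : ℝ) < 1 / 10)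
  refine this.congr fun n => ?_
  rw [Finset.mul_sum]
  refine Finset.sum_congr rfl fun j _ => ?_
  unfold weight
  ring

theorem continuous_birkhoff (s N : ℕ) : Continuous (birkhoff s N) :=
  continuous_finsetSum _ fun _ _ => continuous_const.mul (continuous_fold.iterate _)

/-- This recursion shifts the weights, which is why the starting index `s` is a parameter. -/
theorem birkhoff_succ (s N : ℕ) (x : ℝ) :
    birkhoff s (N + 1) x = weight s * x + birkhoff (s + 1) N (fold x) := by
  unfold birkhoff
  rw [Finset.sum_range_succ', add_comm]
  simp only [Function.iterate_succ_apply, Function.iterate_zero, id, add_zero]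
  congr 1
  refine Finset.sum_congr rfl fun j _ => ?_
  rw [show s + (j + 1) = s + 1 + j by ring]

theorem birkhoff_nonneg (s N : ℕ) {x : ℝ} (hx : x ∈ I) : 0 ≤ birkhoff s N x :=
  Finset.sum_nonneg fun j _ => mul_nonneg (weight_pos _).le (fold_mapsTo.iterate j hx).1

theorem birkhoff_mono (s : ℕ) {x : ℝ} (hx : x ∈ I) : Monotone fun N => birkhoff s N x :=
  monotone_nat_of_le_succ fun N => by
    unfold birkhoff
    rw [Finset.sum_range_succ]
    exact le_add_of_nonneg_right (mul_nonneg (weight_pos _).le (fold_mapsTo.iterate N hx).1)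

/-- `fold` maps three quarters of length `1/4` affinely onto `[0,1]` and collapses the fourth,
`[1/2,3/4]`, to `0`. This loss of mass is what compensates the growth of the exponentials. -/
theorem integral_comp_fold {F : ℝ → ℝ} (hF : Continuous F) :
    ∫ x in (0 : ℝ)..1, F (fold x) = 3 / 4 * (∫ x in (0 : ℝ)..1, F x) + F 0 / 4 := by
  have hc : Continuous fun x => F (fold x) := hF.comp continuous_fold
  have hi : ∀ a b : ℝ, IntervalIntegrable (fun x => F (fold x)) MeasureTheory.volume a b :=
    fun a b => hc.intervalIntegrable a b
  have e1 : ∫ x in (0 : ℝ)..(1 / 4), F (fold x) = 1 / 4 * ∫ x in (0 : ℝ)..1, F x := by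
    rw [intervalIntegral.integral_congr (g := fun x => F (4 * x))]
    · rw [intervalIntegral.integral_comp_mul_left F (by norm_num : (4 : ℝ) ≠ 0)]
      norm_num
    · intro x hx
      rw [uIcc_of_le (by norm_num)] at hx
      simp only [fold]
      rw [min_eq_left (by linarith [hx.2]), max_eq_right (by linarith [hx.1]),
        max_eq_left (by linarith [hx.2]), add_zero]
  have e2 : ∫ x in (1 / 4 : ℝ)..(1 / 2), F (fold x) = 1 / 4 * ∫ x in (0 : ℝ)..1, F x := by
    rw [intervalIntegral.integral_congr (g := fun x => F (2 - 4 * x))]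
    · rw [intervalIntegral.integral_comp_sub_mul F (by norm_num : (4 : ℝ) ≠ 0)]
      norm_num
    · intro x hx
      rw [uIcc_of_le (by norm_num)] at hx
      simp only [fold]
      rw [min_eq_right (by linarith [hx.1]), max_eq_right (by linarith [hx.2]),
        max_eq_left (by linarith [hx.2]), add_zero]
  have e3 : ∫ x in (1 / 2 : ℝ)..(3 / 4), F (fold x) = F 0 / 4 := by
    rw [intervalIntegral.integral_congr (g := fun _ => F 0)]
    · rw [intervalIntegral.integral_const, smul_eq_mul]
      ring
    · intro x hx
      rw [uIcc_of_le (by norm_num)] at hx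
      simp only [fold]
      rw [max_eq_left ((min_le_right _ _).trans (by linarith [hx.1])),
        max_eq_left (by linarith [hx.2]), add_zero]
  have e4 : ∫ x in (3 / 4 : ℝ)..1, F (fold x) = 1 / 4 * ∫ x in (0 : ℝ)..1, F x := by
    rw [intervalIntegral.integral_congr (g := fun x => F (4 * x - 3))]
    · rw [intervalIntegral.integral_comp_mul_sub F (by norm_num : (4 : ℝ) ≠ 0)]
      norm_num
    · intro x hx
      rw [uIcc_of_le (by norm_num)] at hx
      simp only [fold]
      rw [max_eq_left ((min_le_right _ _).trans (by linarith [hx.1])),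
        max_eq_right (by linarith [hx.1]), zero_add]
  rw [← intervalIntegral.integral_add_adjacent_intervals (hi 0 (1 / 4)) (hi (1 / 4) 1),
    ← intervalIntegral.integral_add_adjacent_intervals (hi (1 / 4) (1 / 2)) (hi (1 / 2) 1),
    ← intervalIntegral.integral_add_adjacent_intervals (hi (1 / 2) (3 / 4)) (hi (3 / 4) 1),
    e1, e2, e3, e4]
  ring

theorem exp_two_weight_le (s : ℕ) : Real.exp (2 * weight s) ≤ 5 / 4 := by
  have h1 : Real.exp (2 * weight s) ≤ Real.exp (1 / 5) :=
    Real.exp_le_exp.2 (by linarith [weight_le s])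
  have h2 : Real.exp (1 / 5) ≤ 1 / (1 - 1 / 5) :=
    Real.exp_bound_div_one_sub_of_interval (by norm_num) (by norm_num)
  exact h1.trans (h2.trans (by norm_num))

/-- Each step maps a bound `c` to `5/4 * (3/4 * c + 1/4)`, and `5` is the fixed point of this map.
-/
theorem integral_exp_birkhoff_le (s N : ℕ) :
    ∫ x in (0 : ℝ)..1, Real.exp (2 * birkhoff s N x) ≤ 5 := by
  induction N generalizing s with
  | zero => simp [birkhoff]
  | succ N ih =>
    have hF : Continuous fun y => Real.exp (2 * birkhoff (s + 1) N y) :=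
      (continuous_const.mul (continuous_birkhoff _ _)).rexp
    have hle : ∫ x in (0 : ℝ)..1, Real.exp (2 * birkhoff s (N + 1) x) ≤
        ∫ x in (0 : ℝ)..1, 5 / 4 * Real.exp (2 * birkhoff (s + 1) N (fold x)) := by
      refine intervalIntegral.integral_mono_on zero_le_one
        ((continuous_const.mul (continuous_birkhoff _ _)).rexp.intervalIntegrable _ _)
        ((continuous_const.mul (hF.comp continuous_fold)).intervalIntegrable _ _) fun x hx => ?_
      rw [birkhoff_succ, mul_add, Real.exp_add]
      refine mul_le_mul_of_nonneg_right (le_trans ?_ (exp_two_weight_le s)) (Real.exp_nonneg _)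
      refine Real.exp_le_exp.2 ?_
      have : weight s * x ≤ weight s := mul_le_of_le_one_right (weight_pos s).le hx.2
      linarith
    rw [intervalIntegral.integral_const_mul,
      integral_comp_fold (F := fun y => Real.exp (2 * birkhoff (s + 1) N y)) hF] at hle
    have hz : birkhoff (s + 1) N 0 = 0 := by
      have : ∀ j, fold^[j] 0 = 0 := fun j => Function.iterate_fixed (by norm_num [fold]) j
      simp [birkhoff, this]
    simp only [hz, mul_zero, Real.exp_zero] at hle
    linarith [ih (s + 1)]

/-- The change of `birkhoff 0 N` along `branch i`, in the limit `N → ∞`. -/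
noncomputable def defect (i : Fin 2) (x : ℝ) : ℝ :=
  weight 0 * branch i x - ∑' j, (weight j - weight (j + 1)) * fold^[j] x

theorem hasSum_weight_sub : HasSum (fun j => weight j - weight (j + 1)) (weight 0) := by
  rw [hasSum_iff_tendsto_nat_of_nonneg fun j => sub_nonneg.2 (weight_antitone j.le_succ)]
  have : ∀ n, ∑ j ∈ Finset.range n, (weight j - weight (j + 1)) = weight 0 - weight n :=
    Finset.sum_range_sub' weight
  simp only [this]
  simpa using tendsto_weight.const_sub (weight 0)

theorem norm_defect_term_le (j : ℕ) {x : ℝ} (hx : x ∈ I) :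
    ‖(weight j - weight (j + 1)) * fold^[j] x‖ ≤ weight j - weight (j + 1) := by
  have h0 : 0 ≤ weight j - weight (j + 1) := sub_nonneg.2 (weight_antitone j.le_succ)
  have h := fold_mapsTo.iterate j hx
  rw [Real.norm_of_nonneg (mul_nonneg h0 h.1)]
  exact mul_le_of_le_one_right h0 h.2

theorem continuous_branch (i : Fin 2) : Continuous (branch i) := by unfold branch; fun_prop

theorem continuousOn_defect (i : Fin 2) : ContinuousOn (defect i) I :=
  (continuous_const.mul (continuous_branch i)).continuousOn.sub
    (continuousOn_tsum (fun j => (continuous_const.mul (continuous_fold.iterate j)).continuousOn)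
      hasSum_weight_sub.summable fun j _ hx => norm_defect_term_le j hx)

theorem abs_defect_le (i : Fin 2) {x : ℝ} (hx : x ∈ I) : |defect i x| ≤ 1 / 10 := by
  have hs : Summable fun j => (weight j - weight (j + 1)) * fold^[j] x :=
    Summable.of_norm_bounded hasSum_weight_sub.summable fun j => norm_defect_term_le j hx
  have h0 : 0 ≤ ∑' j, (weight j - weight (j + 1)) * fold^[j] x :=
    tsum_nonneg fun j => mul_nonneg (sub_nonneg.2 (weight_antitone j.le_succ))
      (fold_mapsTo.iterate j hx).1
  have h1 : ∑' j, (weight j - weight (j + 1)) * fold^[j] x ≤ weight 0 := by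
    rw [← hasSum_weight_sub.tsum_eq]
    exact hs.tsum_le_tsum (fun j => (le_abs_self _).trans (norm_defect_term_le j hx))
      hasSum_weight_sub.summable
  have hb := branch_mapsTo i hx
  have h2 : weight 0 * branch i x ≤ weight 0 := mul_le_of_le_one_right (weight_pos 0).le hb.2
  have h3 : 0 ≤ weight 0 * branch i x := mul_nonneg (weight_pos 0).le hb.1
  have h4 := weight_le 0
  unfold defect
  rw [abs_le]
  constructor <;> linarith

/-- `fold` undoes the branch, so the two sums run over the same orbit with weights shifted by one;
only differences of weights remain, and these are summable. -/
theorem birkhoff_branch_sub (i : Fin 2) (N : ℕ) {x : ℝ} (hx : x ∈ I) :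
    birkhoff 0 (N + 1) (branch i x) - birkhoff 0 N x =
      weight 0 * branch i x -
        ∑ j ∈ Finset.range N, (weight j - weight (j + 1)) * fold^[j] x := by
  rw [birkhoff_succ, fold_branch i hx, add_sub_assoc, sub_eq_add_neg (weight 0 * branch i x)]
  congr 1
  unfold birkhoff
  rw [← Finset.sum_sub_distrib, ← Finset.sum_neg_distrib]
  refine Finset.sum_congr rfl fun j _ => ?_
  rw [zero_add, zero_add, add_comm 1 j]
  ring

theorem birkhoff_branch_sub_tendsto (i : Fin 2) :
    TendstoUniformlyOn (fun N x => birkhoff 0 (N + 1) (branch i x) - birkhoff 0 N x) (defect i)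
      atTop I := by
  have h1 := tendstoUniformlyOn_tsum_nat (f := fun j x => (weight j - weight (j + 1)) * fold^[j] x)
    (s := I) hasSum_weight_sub.summable fun j x hx => norm_defect_term_le j hx
  rw [Metric.tendstoUniformlyOn_iff] at h1 ⊢
  intro ε hε
  filter_upwards [h1 ε hε] with N hN x hx
  have := hN x hx
  rw [birkhoff_branch_sub i N hx, defect]
  rwa [dist_sub_left]

/-! ### The limiting homeomorphism -/

/-- The primitive of `exp (birkhoff 0 N)`. -/
noncomputable def preHomeo (N : ℕ) (x : ℝ) : ℝ := ∫ t in (0 : ℝ)..x, Real.exp (birkhoff 0 N t)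

theorem intervalIntegrable_exp_birkhoff (N : ℕ) (a b : ℝ) :
    IntervalIntegrable (fun t => Real.exp (birkhoff 0 N t)) MeasureTheory.volume a b :=
  (continuous_birkhoff 0 N).rexp.intervalIntegrable a b

theorem preHomeo_sub (N : ℕ) (x y : ℝ) :
    preHomeo N y - preHomeo N x = ∫ t in x..y, Real.exp (birkhoff 0 N t) :=
  intervalIntegral.integral_interval_sub_left (intervalIntegrable_exp_birkhoff N _ _)
    (intervalIntegrable_exp_birkhoff N _ _)

theorem sub_le_preHomeo_sub (N : ℕ) {x y : ℝ} (hx : x ∈ I) (hy : y ∈ I) (hxy : x ≤ y) :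
    y - x ≤ preHomeo N y - preHomeo N x := by
  rw [preHomeo_sub]
  have h : ∫ _ in x..y, (1 : ℝ) ≤ ∫ t in x..y, Real.exp (birkhoff 0 N t) := by
    refine intervalIntegral.integral_mono_on hxy (by simp) (intervalIntegrable_exp_birkhoff N _ _)
      fun t ht => Real.one_le_exp (birkhoff_nonneg 0 N ⟨hx.1.trans ht.1, ht.2.trans hy.2⟩)
  simpa using h

/-- From `r ≤ T + r ^ 2 / T` and the `L²` bound. The estimate is uniform in `N` and, for large `T`,
prevents the mass from concentrating, so the limit is continuous. -/
theorem preHomeo_sub_le (N : ℕ) {x y T : ℝ} (hx : x ∈ I) (hy : y ∈ I) (hxy : x ≤ y) (hT : 0 < T) :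
    preHomeo N y - preHomeo N x ≤ T * (y - x) + 5 / T := by
  rw [preHomeo_sub]
  have hc : Continuous fun t => Real.exp (2 * birkhoff 0 N t) :=
    (continuous_const.mul (continuous_birkhoff 0 N)).rexp
  calc ∫ t in x..y, Real.exp (birkhoff 0 N t)
      ≤ ∫ t in x..y, (T + T⁻¹ * Real.exp (2 * birkhoff 0 N t)) := by
        refine intervalIntegral.integral_mono_on hxy (intervalIntegrable_exp_birkhoff N _ _)
          ((continuous_const.add (continuous_const.mul hc)).intervalIntegrable _ _) fun t _ => ?_
        rw [two_mul, Real.exp_add]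
        set r := Real.exp (birkhoff 0 N t)
        have hr : 0 < r := Real.exp_pos _
        have e : T + T⁻¹ * (r * r) - r = T⁻¹ * ((T - r / 2) ^ 2 + 3 / 4 * r ^ 2) := by
          field_simp; ring
        have : 0 ≤ T⁻¹ * ((T - r / 2) ^ 2 + 3 / 4 * r ^ 2) := by positivity
        linarith
    _ = T * (y - x) + T⁻¹ * ∫ t in x..y, Real.exp (2 * birkhoff 0 N t) := by
        rw [intervalIntegral.integral_add (f := fun _ => T)
          (g := fun t => T⁻¹ * Real.exp (2 * birkhoff 0 N t)) (by simp)
          ((continuous_const.mul hc).intervalIntegrable _ _), intervalIntegral.integral_const,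
          intervalIntegral.integral_const_mul, smul_eq_mul, mul_comm T]
    _ ≤ T * (y - x) + T⁻¹ * 5 := by
        gcongr
        refine le_trans ?_ (integral_exp_birkhoff_le 0 N)
        exact intervalIntegral.integral_mono_interval hx.1 hxy hy.2
          (Eventually.of_forall fun t => (Real.exp_nonneg _)) (hc.intervalIntegrable _ _)
    _ = _ := by ring

theorem preHomeo_mono {x : ℝ} (hx : x ∈ I) : Monotone fun N => preHomeo N x := by
  intro N N' hN
  refine intervalIntegral.integral_mono_on hx.1 (intervalIntegrable_exp_birkhoff N _ _)
    (intervalIntegrable_exp_birkhoff N' _ _) fun t ht => ?_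
  exact Real.exp_le_exp.2 (birkhoff_mono 0 ⟨ht.1, ht.2.trans hx.2⟩ hN)

/-- The limit of the maps `preHomeo N`. -/
noncomputable def limHomeo (x : ℝ) : ℝ := ⨆ N, preHomeo N x

theorem tendsto_preHomeo {x : ℝ} (hx : x ∈ I) :
    Tendsto (fun N => preHomeo N x) atTop (𝓝 (limHomeo x)) := by
  refine tendsto_atTop_ciSup (preHomeo_mono hx) ⟨6, ?_⟩
  rintro _ ⟨N, rfl⟩
  have := preHomeo_sub_le N (x := 0) (by simp) hx hx.1 one_pos
  have h0 : preHomeo N 0 = 0 := intervalIntegral.integral_same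
  simp only
  linarith [hx.2]

theorem limHomeo_zero : limHomeo 0 = 0 := by
  simp [limHomeo, preHomeo]

theorem sub_le_limHomeo_sub {x y : ℝ} (hx : x ∈ I) (hy : y ∈ I) (hxy : x ≤ y) :
    y - x ≤ limHomeo y - limHomeo x :=
  ge_of_tendsto' ((tendsto_preHomeo hy).sub (tendsto_preHomeo hx))
    fun N => sub_le_preHomeo_sub N hx hy hxy

theorem limHomeo_sub_le {x y T : ℝ} (hx : x ∈ I) (hy : y ∈ I) (hxy : x ≤ y) (hT : 0 < T) :
    limHomeo y - limHomeo x ≤ T * (y - x) + 5 / T :=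
  le_of_tendsto' ((tendsto_preHomeo hy).sub (tendsto_preHomeo hx))
    fun N => preHomeo_sub_le N hx hy hxy hT

theorem continuousOn_limHomeo : ContinuousOn limHomeo I := by
  have key : ∀ x ∈ I, ∀ y ∈ I, ∀ T : ℝ, 0 < T →
      |limHomeo x - limHomeo y| ≤ T * |x - y| + 5 / T := by
    intro x hx y hy T hT
    rcases le_total x y with h | h
    · rw [abs_sub_comm, abs_sub_comm x, abs_of_nonneg (sub_nonneg.2 h),
        abs_of_nonneg (by linarith [sub_le_limHomeo_sub hx hy h])]
      exact limHomeo_sub_le hx hy h hT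
    · rw [abs_of_nonneg (sub_nonneg.2 h),
        abs_of_nonneg (by linarith [sub_le_limHomeo_sub hy hx h])]
      exact limHomeo_sub_le hy hx h hT
  rw [Metric.continuousOn_iff]
  intro x hx ε hε
  refine ⟨ε / 2 / (10 / ε), by positivity, fun y hy hxy => ?_⟩
  have h1 := key y hy x hx (10 / ε) (by positivity)
  rw [Real.dist_eq] at hxy ⊢
  rw [lt_div_iff₀ (by positivity)] at hxy
  have h2 : 5 / (10 / ε) = ε / 2 := by field_simp; norm_num
  linarith

theorem preHomeo_branch_sub (i : Fin 2) (N : ℕ) (x y : ℝ) :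
    preHomeo (N + 1) (branch i y) - preHomeo (N + 1) (branch i x) =
      (∫ t in x..y, Real.exp (birkhoff 0 (N + 1) (branch i t))) / 4 := by
  have e : ∀ t, branch i t = t / 4 + ![0, 3] i / 4 := fun t => by unfold branch; ring
  rw [preHomeo_sub]
  simp only [e]
  rw [intervalIntegral.integral_comp_div_add (fun t => Real.exp (birkhoff 0 (N + 1) t))
    (by norm_num : (4 : ℝ) ≠ 0), smul_eq_mul]
  ring

/-- The limiting homeomorphism turns the affine branches into maps of derivative
`exp (defect i) / 4`. -/
theorem limHomeo_branch_sub_mem (i : Fin 2) {x y m M : ℝ} (hx : x ∈ I) (hy : y ∈ I) (hxy : x ≤ y)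
    (hb : ∀ t ∈ Icc x y, m ≤ defect i t ∧ defect i t ≤ M) :
    Real.exp m / 4 * (limHomeo y - limHomeo x) ≤
        limHomeo (branch i y) - limHomeo (branch i x) ∧
      limHomeo (branch i y) - limHomeo (branch i x) ≤
        Real.exp M / 4 * (limHomeo y - limHomeo x) := by
  have hl1 : Tendsto (fun N => preHomeo (N + 1) (branch i y) - preHomeo (N + 1) (branch i x)) atTop
      (𝓝 (limHomeo (branch i y) - limHomeo (branch i x))) :=
    ((tendsto_preHomeo (branch_mapsTo i hy)).sub (tendsto_preHomeo (branch_mapsTo i hx))).comp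
      (tendsto_add_atTop_nat 1)
  have hl2 : Tendsto (fun N => preHomeo N y - preHomeo N x) atTop
      (𝓝 (limHomeo y - limHomeo x)) := (tendsto_preHomeo hy).sub (tendsto_preHomeo hx)
  have hint : ∀ N, IntervalIntegrable (fun t => Real.exp (birkhoff 0 (N + 1) (branch i t)))
      MeasureTheory.volume x y := fun N =>
    ((continuous_birkhoff 0 (N + 1)).comp (continuous_branch i)).rexp.intervalIntegrable _ _
  -- Uniform convergence to the defect compares the two densities pointwise up to `exp ε`; after
  -- integration, first `N → ∞`, then `ε → 0`.
  have hε : ∀ ε > 0, ∀ᶠ N in atTop, ∀ t ∈ Icc x y,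
      birkhoff 0 N t + (m - ε) ≤ birkhoff 0 (N + 1) (branch i t) ∧
      birkhoff 0 (N + 1) (branch i t) ≤ birkhoff 0 N t + (M + ε) := by
    intro ε hε
    filter_upwards [Metric.tendstoUniformlyOn_iff.1 (birkhoff_branch_sub_tendsto i) ε hε]
      with N hN t ht
    have h1 := hN t ⟨hx.1.trans ht.1, ht.2.trans hy.2⟩
    rw [Real.dist_eq, abs_lt] at h1
    have h2 := hb t ht
    constructor <;> linarith
  have hcont : ∀ c : ℝ, Tendsto (fun ε : ℝ => Real.exp (c + ε) / 4 * (limHomeo y - limHomeo x))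
      (𝓝[>] 0) (𝓝 (Real.exp c / 4 * (limHomeo y - limHomeo x))) := by
    intro c
    have : Continuous fun ε : ℝ => Real.exp (c + ε) / 4 * (limHomeo y - limHomeo x) := by fun_prop
    have h := (this.tendsto 0).mono_left (nhdsWithin_le_nhds (s := Ioi 0))
    rwa [add_zero] at h
  have hcont' : ∀ c : ℝ, Tendsto (fun ε : ℝ => Real.exp (c - ε) / 4 * (limHomeo y - limHomeo x))
      (𝓝[>] 0) (𝓝 (Real.exp c / 4 * (limHomeo y - limHomeo x))) := by
    intro c
    have : Continuous fun ε : ℝ => Real.exp (c - ε) / 4 * (limHomeo y - limHomeo x) := by fun_prop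
    have h := (this.tendsto 0).mono_left (nhdsWithin_le_nhds (s := Ioi 0))
    rwa [sub_zero] at h
  constructor
  · refine le_of_tendsto (hcont' m) ?_
    filter_upwards [self_mem_nhdsWithin] with ε hεpos
    refine le_of_tendsto_of_tendsto (hl2.const_mul (Real.exp (m - ε) / 4)) hl1 ?_
    filter_upwards [hε ε hεpos] with N hN
    rw [preHomeo_branch_sub i N x y, preHomeo_sub, div_mul_eq_mul_div, ← intervalIntegral.integral_const_mul]
    refine div_le_div_of_nonneg_right (intervalIntegral.integral_mono_on hxy
      ((intervalIntegrable_exp_birkhoff N _ _).const_mul _) (hint N) fun t ht => ?_) (by norm_num)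
    rw [← Real.exp_add, add_comm]
    exact Real.exp_le_exp.2 (hN t ht).1
  · refine ge_of_tendsto (hcont M) ?_
    filter_upwards [self_mem_nhdsWithin] with ε hεpos
    refine le_of_tendsto_of_tendsto hl1 (hl2.const_mul (Real.exp (M + ε) / 4)) ?_
    filter_upwards [hε ε hεpos] with N hN
    rw [preHomeo_branch_sub i N x y, preHomeo_sub, div_mul_eq_mul_div, ← intervalIntegral.integral_const_mul]
    refine div_le_div_of_nonneg_right (intervalIntegral.integral_mono_on hxy (hint N)
      ((intervalIntegrable_exp_birkhoff N _ _).const_mul _) fun t ht => ?_) (by norm_num)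
    rw [← Real.exp_add, add_comm (M + ε)]
    exact Real.exp_le_exp.2 (hN t ht).2

/-- `H` itself need not be differentiable. Only ratios of its increments enter, and
`limHomeo_branch_sub_mem` on the short interval between `k z` and `k y` pins them near `exp (defect
i (k z)) / 4`. -/
theorem hasDerivWithinAt_conj_branch {H k : ℝ → ℝ} {T : ℝ} (hT : 0 < T)
    (hH : ∀ x, H x = limHomeo x * T⁻¹) (hkm : MapsTo k I I) (hr : ∀ x ∈ I, H (k x) = x)
    (hkc : ContinuousOn k I) (i : Fin 2) :
    ∀ z ∈ I, HasDerivWithinAt (fun z => H (branch i (k z))) (Real.exp (defect i (k z)) / 4) I z := by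
  intro z hz
  rw [hasDerivWithinAt_iff_isLittleO, Asymptotics.isLittleO_iff]
  intro ε hε
  set a := defect i (k z) with ha
  obtain ⟨η, hη, hexp⟩ := Metric.continuous_iff.1 Real.continuous_exp a ε hε
  have hexp1 : Real.exp a - ε ≤ Real.exp (a - η / 2) := by
    have := hexp (a - η / 2) (by rw [Real.dist_eq, abs_lt]; constructor <;> linarith)
    rw [Real.dist_eq, abs_lt] at this
    linarith
  have hexp2 : Real.exp (a + η / 2) ≤ Real.exp a + ε := by
    have := hexp (a + η / 2) (by rw [Real.dist_eq, abs_lt]; constructor <;> linarith)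
    rw [Real.dist_eq, abs_lt] at this
    linarith
  obtain ⟨δ, hδ, hdef⟩ := Metric.continuousOn_iff.1 (continuousOn_defect i) (k z) (hkm hz)
    (η / 2) (by positivity)
  have hnear : ∀ᶠ y in 𝓝[I] z, dist (k y) (k z) < δ := hkc z hz (Metric.ball_mem_nhds _ hδ)
  have key : ∀ x ∈ I, ∀ y ∈ I, x ≤ y → (∀ t ∈ Icc x y, |t - k z| < δ) →
      |H (branch i y) - H (branch i x) - (H y - H x) * (Real.exp a / 4)| ≤ ε * (H y - H x) := by
    intro x hx y hy hxy ht
    have hb : ∀ t ∈ Icc x y, a - η / 2 ≤ defect i t ∧ defect i t ≤ a + η / 2 := by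
      intro t htm
      have := hdef t ⟨hx.1.trans htm.1, htm.2.trans hy.2⟩ (ht t htm)
      rw [Real.dist_eq, abs_lt] at this
      constructor <;> linarith
    have h0 : 0 ≤ limHomeo y - limHomeo x := by linarith [sub_le_limHomeo_sub hx hy hxy]
    obtain ⟨h1, h2⟩ := limHomeo_branch_sub_mem i hx hy hxy hb
    set Δ := limHomeo y - limHomeo x with hΔ
    set B := limHomeo (branch i y) - limHomeo (branch i x) with hB
    have h3 : (Real.exp a - ε) * Δ ≤ 4 * B := by
      have := mul_le_mul_of_nonneg_right hexp1 h0
      linarith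
    have h4 : 4 * B ≤ (Real.exp a + ε) * Δ := by
      have := mul_le_mul_of_nonneg_right hexp2 h0
      linarith
    have e1 : H (branch i y) - H (branch i x) - (H y - H x) * (Real.exp a / 4) =
        (B - Δ * (Real.exp a / 4)) * T⁻¹ := by
      rw [hH, hH, hH, hH, hB, hΔ]; ring
    have e2 : ε * (H y - H x) = ε * Δ * T⁻¹ := by rw [hH, hH, hΔ]; ring
    rw [e1, e2, abs_mul, abs_of_pos (inv_pos.2 hT)]
    refine mul_le_mul_of_nonneg_right ?_ (inv_pos.2 hT).le
    have h5 : 0 ≤ ε * Δ := by positivity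
    rw [abs_le]
    constructor <;> nlinarith
  filter_upwards [self_mem_nhdsWithin, hnear] with y hy hyδ
  rw [Real.dist_eq] at hyδ
  rw [smul_eq_mul, Real.norm_eq_abs, Real.norm_eq_abs]
  rcases le_total (k z) (k y) with h | h
  · have := key _ (hkm hz) _ (hkm hy) h fun t ht => by
      rw [abs_of_nonneg (by linarith [ht.1])]
      linarith [ht.2, le_abs_self (k y - k z)]
    rw [hr z hz, hr y hy] at this
    exact this.trans (by gcongr; exact le_abs_self _)
  · have := key _ (hkm hy) _ (hkm hz) h fun t ht => by
      rw [abs_of_nonpos (by linarith [ht.2])]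
      linarith [ht.1, neg_abs_le (k y - k z)]
    rw [hr z hz, hr y hy] at this
    rw [← abs_neg, abs_sub_comm y]
    refine le_trans (le_of_eq ?_) (this.trans (by gcongr; exact le_abs_self _))
    congr 1
    ring

theorem birkhoff_add_sub_tendsto (n : ℕ) {x : ℝ} (hx : x ∈ I) :
    Tendsto (fun N => birkhoff 0 (N + n) x - birkhoff 0 N x) atTop (𝓝 0) := by
  have e : ∀ N, birkhoff 0 (N + n) x - birkhoff 0 N x =
      ∑ j ∈ Finset.range n, weight (N + j) * fold^[N + j] x := by
    intro N
    unfold birkhoff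
    rw [Finset.sum_range_add]
    simp
  simp only [e]
  have h0 : (0 : ℝ) = ∑ _j ∈ Finset.range n, 0 := by simp
  rw [h0]
  refine tendsto_finsetSum _ fun j _ => ?_
  have hw : Tendsto (fun N => weight (N + j)) atTop (𝓝 0) :=
    tendsto_weight.comp (tendsto_add_atTop_nat j)
  refine squeeze_zero (fun N => mul_nonneg (weight_pos _).le (fold_mapsTo.iterate _ hx).1)
    (fun N => ?_) hw
  exact mul_le_of_le_one_right (weight_pos _).le (fold_mapsTo.iterate _ hx).2

/-- The first `n` points of the `fold`-orbit all lie in the range `[3/4,1]` of the second branch. -/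
theorem le_birkhoff_replicate (s n : ℕ) :
    3 / 4 * ∑ j ∈ Finset.range n, weight (s + j) ≤
      birkhoff s n (wordMap branch (List.replicate n 1) 0) := by
  induction n generalizing s with
  | zero => simp [birkhoff]
  | succ n ih =>
    have hI := wordMap_mapsTo branch_mapsTo (List.replicate n 1) (x := 0) (by simp)
    rw [List.replicate_succ]
    simp only [wordMap, Function.comp_apply]
    rw [birkhoff_succ, fold_branch 1 hI, Finset.sum_range_succ', mul_add, add_comm]
    refine add_le_add ?_ ?_
    · rw [add_zero, mul_comm]
      refine mul_le_mul_of_nonneg_left ?_ (weight_pos s).le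
      have := hI.1
      simp only [branch]
      norm_num
      linarith
    · refine le_trans (le_of_eq ?_) (ih (s + 1))
      congr 1
      refine Finset.sum_congr rfl fun j _ => ?_
      rw [show s + (j + 1) = s + 1 + j by ring]

/-- A hyperbolic system of class `C^1` with the Livsic condition which is not `C^1`-conjugate to a
pseudo-affine one. -/
theorem exists_not_conjugate :
    ∃ lam : ℝ, 0 < lam ∧ lam < 1 / 2 ∧
      ∃ g : Fin 2 → ℝ → ℝ,
        IsHyperbolic (.cont 1) g ∧ LivsicCondition g lam ∧
        ∀ (f : Fin 2 → ℝ → ℝ) (mu : ℝ),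
          IsSelfConformal (.cont 1) f → IsPseudoAffine f mu → ¬ IsConjugate (.cont 1) g f := by
  have i0 : (0 : ℝ) ∈ I := by simp
  have i1 : (1 : ℝ) ∈ I := by simp
  set T := limHomeo 1 with hTdef
  have hT1 : 1 ≤ T := by
    have := sub_le_limHomeo_sub i0 i1 zero_le_one
    rw [limHomeo_zero] at this
    linarith
  have hT : 0 < T := by linarith
  set H : ℝ → ℝ := fun x => limHomeo x * T⁻¹ with hH
  have hH0 : H 0 = 0 := by simp [hH, limHomeo_zero]
  have hH1 : H 1 = 1 := mul_inv_cancel₀ hT.ne'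
  have hHc : ContinuousOn H I := continuousOn_limHomeo.mul continuousOn_const
  have hHlow : ∀ x ∈ I, ∀ y ∈ I, x ≤ y → T⁻¹ * (y - x) ≤ H y - H x := by
    intro x hx y hy hxy
    have := mul_le_mul_of_nonneg_left (sub_le_limHomeo_sub hx hy hxy) (inv_pos.2 hT).le
    simp only [hH]
    linarith
  have hHlt : ∀ x ∈ I, ∀ y ∈ I, x < y → H x < H y := by
    intro x hx y hy hxy
    have := hHlow x hx y hy hxy.le
    nlinarith [mul_pos (inv_pos.2 hT) (sub_pos.2 hxy)]
  obtain ⟨k, hHm, hkm, hkH, hHk, hkL⟩ := exists_inverse hHc hH0 hH1 (inv_pos.2 hT) hHlow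
  have hk0 : k 0 = 0 := by have := hkH 0 i0; rwa [hH0] at this
  have hk1 : k 1 = 1 := by have := hkH 1 i1; rwa [hH1] at this
  have hkc := continuousOn_of_lipschitz hkL
  let g : Fin 2 → ℝ → ℝ := fun i z => H (branch i (k z))
  let d : Fin 2 → ℝ → ℝ := fun i z => Real.exp (defect i (k z)) / 4
  have hm : ∀ i, MapsTo (g i) I I := fun i z hz => hHm (branch_mapsTo i (hkm hz))
  have hd : ∀ i, ∀ z ∈ I, HasDerivWithinAt (g i) (d i z) I z := fun i =>
    hasDerivWithinAt_conj_branch hT (fun _ => rfl) hkm hHk hkc i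
  have hdc : ∀ i, ContinuousOn (d i) I := fun i =>
    (((continuousOn_defect i).comp hkc hkm).rexp).div_const 4
  have hdw : ∀ i, ∀ z ∈ I, derivWithin (g i) I z = d i z := fun i z hz =>
    HasDerivWithinAt.derivWithin_I hz (hd i z hz)
  have hdpos : ∀ i, ∀ z ∈ I, 0 < d i z := fun i z _ => div_pos (Real.exp_pos _) (by norm_num)
  have hdlow : ∀ i, ∀ z ∈ I, 1 / 8 ≤ d i z := by
    intro i z hz
    have h1 := (abs_le.1 (abs_defect_le i (hkm hz))).1
    have h2 := Real.add_one_le_exp (defect i (k z))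
    simp only [d]
    linarith
  have hdup : ∀ i, ∀ z ∈ I, d i z ≤ 1 / 2 := by
    intro i z hz
    have h1 := (abs_le.1 (abs_defect_le i (hkm hz))).2
    have h2 : Real.exp (defect i (k z)) ≤ Real.exp (1 / 10) := Real.exp_le_exp.2 h1
    have h3 : Real.exp (1 / 10) ≤ 1 / (1 - 1 / 10) :=
      Real.exp_bound_div_one_sub_of_interval (by norm_num) (by norm_num)
    have h4 : (1 : ℝ) / (1 - 1 / 10) ≤ 2 := by norm_num
    simp only [d]
    linarith
  have hLip : ∀ i, ∀ x ∈ I, ∀ y ∈ I, |g i x - g i y| ≤ 1 / 2 * |x - y| := fun i =>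
    lipschitz_of_deriv_le (hd i) fun x hx => by
      rw [abs_of_pos (hdpos i x hx)]; exact hdup i x hx
  have hb00 : branch 0 0 = 0 := by simp [branch]
  have hb01 : branch 0 1 = 1 / 4 := by norm_num [branch]
  have hb10 : branch 1 0 = 3 / 4 := by norm_num [branch]
  have hb11 : branch 1 1 = 1 := by norm_num [branch]
  have hg00 : g 0 0 = 0 := by simp only [g]; rw [hk0, hb00, hH0]
  have hq : (1 / 4 : ℝ) ∈ I := by constructor <;> norm_num
  have hq' : (3 / 4 : ℝ) ∈ I := by constructor <;> norm_num
  have hcls : ∀ i, IsOfClass (.cont 1) (g i) := fun i => by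
    have hs : (Regularity.cont 1).Admissible := le_refl 1
    refine hs.isOfClass_iff.2 fun p hp => ?_
    obtain rfl : p = (none, 1 - 1) := hp
    exact ⟨d i, hd i, hdc i⟩
  -- The defects add up along `w` to a limit of differences of Birkhoff sums, although the sums
  -- themselves may diverge.
  have hword : ∀ w : List (Fin 2), ∀ x ∈ I,
      wordMap g w (H x) = H (wordMap branch w x) ∧
      ∃ E, wordDeriv g d w (H x) = (1 / 4) ^ w.length * Real.exp E ∧
        Tendsto (fun N => birkhoff 0 (N + w.length) (wordMap branch w x) - birkhoff 0 N x) atTop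
          (𝓝 E) := by
    intro w x hx
    induction w with
    | nil => exact ⟨rfl, 0, by simp [wordDeriv], by simp [wordMap]⟩
    | cons i w ih =>
      obtain ⟨hw, E, hE, hlim⟩ := ih
      have hI := wordMap_mapsTo branch_mapsTo w hx
      have hkw : k (wordMap g w (H x)) = wordMap branch w x := by rw [hw, hkH _ hI]
      refine ⟨?_, defect i (wordMap branch w x) + E, ?_, ?_⟩
      · change H (branch i (k (wordMap g w (H x)))) = H (branch i (wordMap branch w x))
        rw [hkw]
      · simp only [wordDeriv, d, List.length_cons]
        rw [hkw, hE, Real.exp_add]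
        ring
      · have h1 := ((birkhoff_branch_sub_tendsto i).tendsto_at hI).comp
          (tendsto_add_atTop_nat w.length)
        refine (h1.add hlim).congr fun N => ?_
        simp only [Function.comp_apply, List.length_cons, wordMap]
        rw [add_assoc N]
        ring
  have hd00 : d 0 0 = 1 / 4 := by
    have h1 := hword [0] 0 i0
    obtain ⟨-, E, hE, hlim⟩ := h1
    have hE0 : E = 0 := by
      refine tendsto_nhds_unique hlim ?_
      simp only [wordMap, Function.comp_apply, id, hb00]
      exact birkhoff_add_sub_tendsto 1 i0
    rw [hE0, hH0] at hE
    simpa [wordDeriv, wordMap] using hE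
  refine ⟨1 / 4, by norm_num, by norm_num, g, ⟨⟨hm, hcls, ?_, ?_⟩, ?_, hg00, ?_, ?_, ?_, ?_⟩, ?_, ?_⟩
  · intro i z hz
    rw [hdw i z hz]
    exact (hdpos i z hz).ne'
  · exact ⟨1 / 2, by norm_num, hLip⟩
  · refine ⟨1 / 8, 1 / 2, by norm_num, by norm_num, fun i z hz => ?_⟩
    rw [hdw i z hz, abs_of_pos (hdpos i z hz)]
    exact ⟨hdlow i z hz, hdup i z hz⟩
  · simp only [g]; rw [hk0, hk1, hb00, hb01]; exact hHlt _ i0 _ hq (by norm_num)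
  · simp only [g]; rw [hk0, hk1, hb01, hb10]; exact hHlt _ hq _ hq' (by norm_num)
  · simp only [g]; rw [hk0, hk1, hb10, hb11]; exact hHlt _ hq' _ i1 (by norm_num)
  · simp only [g]; rw [hk1, hb11, hH1]
  · intro w y hy hfix
    rw [HasDerivWithinAt.derivWithin_I hy (hasDerivWithinAt_wordMap hm hd w y hy)]
    obtain ⟨hw, E, hE, hlim⟩ := hword w (k y) (hkm hy)
    have hI := wordMap_mapsTo branch_mapsTo w (hkm hy)
    rw [hHk y hy] at hw hE
    -- At a fixed point both Birkhoff sums are taken at the same point; they differ by `|w|` terms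
    -- whose weights tend to `0`, so `E = 0`.
    have hfix' : wordMap branch w (k y) = k y := by
      rw [hfix] at hw
      rw [← hkH _ hI, ← hw]
    rw [hfix'] at hlim
    rw [hE, tendsto_nhds_unique hlim (birkhoff_add_sub_tendsto _ (hkm hy)), Real.exp_zero, mul_one]
  · intro f mu hf hmu
    refine not_conjugate_of_unbounded (by norm_num) hm hd (by norm_num) (by norm_num) (hLip 0) hg00
      hd00 (fun C => ?_) hf hmu
    obtain ⟨n, hn⟩ := (tendsto_sum_weight.eventually_gt_atTop (4 / 3 * C)).exists
    refine ⟨List.replicate n 1, ?_⟩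
    obtain ⟨-, E, hE, hlim⟩ := hword (List.replicate n 1) 0 i0
    have hI := wordMap_mapsTo branch_mapsTo (List.replicate n 1) i0
    -- The Birkhoff sums at `0` vanish, so `E` is bounded below by a partial sum of the divergent
    -- series of weights.
    have hCE : C < E := by
      have hle : 3 / 4 * ∑ j ∈ Finset.range n, weight j ≤ E := by
        refine ge_of_tendsto' hlim fun N => ?_
        have h1 := le_birkhoff_replicate 0 n
        have h2 : birkhoff 0 N 0 = 0 := by
          have : ∀ j, fold^[j] 0 = 0 := fun j => Function.iterate_fixed (by norm_num [fold]) j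
          simp [birkhoff, this]
        have h3 := birkhoff_mono 0 hI (Nat.le_add_left n N)
        simp only [zero_add] at h1 h3
        rw [h2, sub_zero, List.length_replicate]
        exact h1.trans h3
      linarith
    rw [hH0] at hE
    rw [hE, mul_comm]
    refine mul_lt_mul_of_pos_left ?_ (by positivity)
    linarith [Real.add_one_le_exp E]

end TwoMapIFS

theorem theoremC :
    (∃ lam : ℝ, 0 < lam ∧ lam < 1 / 2 ∧
      ∃ g : Fin 2 → ℝ → ℝ,
        TwoMapIFS.IsHyperbolic (.cont 1) g ∧ TwoMapIFS.LivsicCondition g lam ∧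
        ∀ (f : Fin 2 → ℝ → ℝ) (mu : ℝ),
          TwoMapIFS.IsSelfConformal (.cont 1) f → TwoMapIFS.IsPseudoAffine f mu →
          ¬ TwoMapIFS.IsConjugate (.cont 1) g f) ∧
    (∀ s : TwoMapIFS.Regularity, s.Admissible → 1 < s.value →
      ∀ (g : Fin 2 → ℝ → ℝ) (lam : ℝ), TwoMapIFS.IsHyperbolic s g → 0 < lam → lam < 1 →
        TwoMapIFS.LivsicCondition g lam →
        lam < 1 / 2 ∧
        ∃ f : Fin 2 → ℝ → ℝ, TwoMapIFS.IsHyperbolic s f ∧ TwoMapIFS.IsPseudoAffine f lam ∧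
          TwoMapIFS.IsConjugate s g f) :=
  ⟨TwoMapIFS.exists_not_conjugate, fun _ hs hs1 _ _ hg h0 _ hL =>
    TwoMapIFS.exists_pseudoAffine_conjugate hs hs1 hg h0 hL⟩
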